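/- **Theorem 6.7.** Let $n\ge 1$, $1\le m\le n+1$, let $\Omega\subset\mathbb R^{n+1}$ be a domain (open, connected, non-empty) whose boundary $\partial\Omega$ is a $C^2$-smooth hypersurface, and let $M_0\in\partial\Omega$. If there exists an $m$-Hessian kernel of local sub-barriers at $M_0$, then $\partial\Omega$ is $(m-1)$-convex at $M_0$. Here the following terms are used. * For a symmetric $k\times k$ matrix $S$, $T_p(S)$ is the sum of all principal minors of order $p$ of $S$, $T_0(S)=1$; $S$ is *$m$-positive* if $T_p(S)>0$ for $p=0,1,\dots,m$. * For an open set $D$, $u\in C^2(\bar D)$ means that $u\in C^2(D)$ and that $u$, its gradient and its Hessian matrix $u_{xx}$ extend continuously to $\bar D$. Such a $u$ is *$m$-admissible in $\bar D$* if the (extended) Hessian $u_{xx}(x)$ is $m$-positive at every $x\in\bar D$. * A set $\Gamma\subset\mathbb R^{n+1}$ is a *$C^2$-smooth hypersurface* if for each $M\in\Gamma$ there are $r>0$, a domain $\Theta\subset\mathbb R^n$ and a $C^2$ map $X=X(\theta)$ which is a homeomorphism of $\Theta$ onto $\Gamma\cap B_r(M)$, with $\det X_\theta^TX_\theta\neq0$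 in $\Theta$. Let $X_k=\partial X/\partial\theta^k$, $g=X_\theta^TX_\theta$, and let $\tau$ be a $C^1$ field of $n\times n$ matrices on $\Theta$ with $\tau\tau^T=g^{-1}$. The invariant derivatives are $f_{(j)}=\sum_k\tau^k_j\,\partial f/\partial\theta^k$, and the *curvature matrix* of $\Gamma$ at $M$ with respect to a unit normal $\mathbf n^+$ is $\mathcal K_{ij}=\big(X_{(i)(j)},\mathbf n^+\big)$, $i,j=1,\dots,n$, where $X_{(i)(j)}=(X_{(i)})_{(j)}$; it is determined up to orthogonal conjugation. * $\partial\Omega$ is *$p$-convex at $M$* if its curvature matrix at $M$ with respect to the interior normal (the unit normal that looks into $\Omega$) is $p$-positive. * A function $W$ is an *$m$-Hessian kernel of local sub-barriers at $M_0\in\partial\Omega$* if there are $r>0$ and a domain $\Omega_r\subset\Omega\cap B_r(M_0)$ whose boundary satisfies $\partial\Omega_r\cap\partial\Omega=\partial\Omega\cap B_r(M_0)$ inside the open ball $B_r(M_0)$, such that $W$ is $m$-admissible in $\bar\Omega_r$ and $$W(M_0)=0,\qquad W\le0\ \text{ on }\ \partial\Omega_r,\qquad W\le-1\ \text{ on }\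 \partial\Omega_r\cap\Omega .$$ -/

import Mathlib

namespace HessianKernel

/-- The arithmetic Euclidean space of dimension `k`, with the Euclidean norm and scalar product. -/
abbrev Euc (k : ℕ) : Type := EuclideanSpace ℝ (Fin k)

/-! ### Traces of matrices and the cones of `m`-positive matrices -/

/-- The `p`-trace `T_p(S)`: the sum of all principal minors of order `p` of `S`
(for `p = 0` the only summand is the empty determinant, so `T_0(S) = 1`). -/
noncomputable def pTrace {k : ℕ} (p : ℕ) (S : Matrix (Fin k) (Fin k) ℝ) : ℝ :=
  ∑ s ∈ (Finset.univ : Finset (Fin k)).powersetCard p,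
    (S.submatrix (fun i : s => (i : Fin k)) (fun i : s => (i : Fin k))).det

/-- `S` belongs to the cone `K_m`: it is symmetric and `T_p(S) > 0` for `p = 0, 1, …, m`. -/
def IsMPositive {k : ℕ} (m : ℕ) (S : Matrix (Fin k) (Fin k) ℝ) : Prop :=
  S.IsSymm ∧ ∀ p, p ≤ m → 0 < pTrace p S

/-! ### Partial derivatives, the gradient and the Hessian -/

/-- The partial derivative `∂f/∂θ^i`. -/
noncomputable def pderiv {k : ℕ} {F : Type*} [NormedAddCommGroup F] [NormedSpace ℝ F]
    (i : Fin k) (f : Euc k → F) (x : Euc k) : F :=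
  fderiv ℝ f x (EuclideanSpace.single i 1)

/-- The Hessian matrix `u_{xx}`. -/
noncomputable def hessianMatrix {k : ℕ} (u : Euc k → ℝ) (x : Euc k) : Matrix (Fin k) (Fin k) ℝ :=
  Matrix.of fun i j => pderiv i (pderiv j u) x

/-- `u ∈ C²(D̄)` for an open set `D`: `u` is twice continuously differentiable in `D`, and `u` and
its derivatives of order one and two extend continuously to `D̄`. The values of `u` on `D̄` are those
of the extension, and `G`, `H` are the extended gradient and Hessian, which are
determined on `D̄` by `u`. -/
structure IsC2UpToBoundary {k : ℕ} (D : Set (Euc k)) (u : Euc k → ℝ)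
    (G : Euc k → Fin k → ℝ) (H : Euc k → Matrix (Fin k) (Fin k) ℝ) : Prop where
  contDiffOn : ContDiffOn ℝ 2 u D
  continuousOn : ContinuousOn u (closure D)
  continuousOn_grad : ContinuousOn G (closure D)
  continuousOn_hess : ContinuousOn H (closure D)
  grad_eq : ∀ x ∈ D, ∀ i, G x i = pderiv i u x
  hess_eq : ∀ x ∈ D, H x = hessianMatrix u x

/-- `u ∈ 𝕂_m(D̄)`: `u` is of class `C²(D̄)` and is `m`-admissible at every point of `D̄`, that is,
its Hessian matrix is `m`-positive there. -/
def IsMAdmissible {k : ℕ} (m : ℕ) (D : Set (Euc k)) (u : Euc k → ℝ) : Prop :=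
  ∃ G H, IsC2UpToBoundary D u G H ∧ ∀ x ∈ closure D, IsMPositive m (H x)

/-! ### Hypersurfaces, invariant derivatives, the curvature matrix -/

/-- The metric tensor `g_{ij} = (X_i, X_j)` of a parametrization `X`. -/
noncomputable def metricTensor {k N : ℕ} (X : Euc k → Euc N) (θ : Euc k) :
    Matrix (Fin k) (Fin k) ℝ :=
  Matrix.of fun i j => inner ℝ (pderiv i X θ) (pderiv j X θ)

/-- `X : Θ → Γ ∩ B_r(M)`, for some `r > 0`, is a `C²` local parametrization of the hypersurface `Γ`
near `M`: `Θ` is a domain, `X` is a homeomorphism of `Θ` onto `Γ ∩ B_r(M)`, of class `C²`, and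
`det (X_θᵀ X_θ) ≠ 0`. -/
structure IsLocalParam {n : ℕ} (Γ : Set (Euc (n + 1))) (M : Euc (n + 1))
    (Θ : Set (Euc n)) (X : Euc n → Euc (n + 1)) : Prop where
  isOpen : IsOpen Θ
  isConnected : IsConnected Θ
  contDiffOn : ContDiffOn ℝ 2 X Θ
  isEmbedding : Topology.IsEmbedding (fun θ : Θ => X θ)
  image_eq : ∃ r : ℝ, 0 < r ∧ X '' Θ = Γ ∩ Metric.ball M r
  det_ne_zero : ∀ θ ∈ Θ, (metricTensor X θ).det ≠ 0

/-- `Γ ⊆ ℝ^{n+1}` is a `C²`-smooth hypersurface (not necessarily connected). -/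
def IsC2Hypersurface {n : ℕ} (Γ : Set (Euc (n + 1))) : Prop :=
  ∀ M ∈ Γ, ∃ Θ X, IsLocalParam Γ M Θ X

/-- The invariant partial derivative `f_{(j)} = f_k τ^k_j`. -/
noncomputable def invDeriv {n : ℕ} {F : Type*} [NormedAddCommGroup F] [NormedSpace ℝ F]
    (τ : Euc n → Matrix (Fin n) (Fin n) ℝ) (j : Fin n) (f : Euc n → F) (θ : Euc n) : F :=
  ∑ k, τ θ k j • pderiv k f θ

/-- `τ` is a `C¹` field of matrices with `g⁻¹ = τ τᵀ` on `Θ`. All fields `√(g⁻¹) B` with constant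
orthogonal `B` are of this kind. -/
def IsFrameField {n N : ℕ} (Θ : Set (Euc n)) (X : Euc n → Euc N)
    (τ : Euc n → Matrix (Fin n) (Fin n) ℝ) : Prop :=
  (∀ i j, ContDiffOn ℝ 1 (fun θ => τ θ i j) Θ) ∧
    ∀ θ ∈ Θ, (metricTensor X θ)⁻¹ = τ θ * (τ θ).transpose

/-- The curvature matrix `𝒦_{ij} = (X_{(i)(j)}, ν)` at the point `X(θ)`, for the unit normal `ν`
at this point; here `X_{(i)(j)} = (X_{(i)})_{(j)}`. -/
noncomputable def curvatureMatrix {n : ℕ} (X : Euc n → Euc (n + 1))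
    (τ : Euc n → Matrix (Fin n) (Fin n) ℝ) (ν : Euc (n + 1)) (θ : Euc n) :
    Matrix (Fin n) (Fin n) ℝ :=
  Matrix.of fun i j => inner ℝ (invDeriv τ j (invDeriv τ i X) θ) ν

/-- `ν` is a unit normal to `Γ` at `M`: it has length one and is orthogonal to all the tangent
vectors `X_j`. -/
def IsUnitNormal {n : ℕ} (Γ : Set (Euc (n + 1))) (M ν : Euc (n + 1)) : Prop :=
  ‖ν‖ = 1 ∧ ∀ Θ X, IsLocalParam Γ M Θ X → ∀ θ ∈ Θ, X θ = M → ∀ j, inner ℝ (pderiv j X θ) ν = 0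

/-- The hypersurface `Γ`, oriented at `M ∈ Γ` by the unit normal `ν`, is `p`-convex at `M`: its
curvature matrix at `M` is `p`-positive. Curvature matrices for different parametrizations and
different `τ` are orthogonally conjugate, and all of them are required to be `p`-positive. -/
def IsPConvexAt {n : ℕ} (p : ℕ) (Γ : Set (Euc (n + 1))) (ν M : Euc (n + 1)) : Prop :=
  ∀ Θ X, IsLocalParam Γ M Θ X → ∀ τ, IsFrameField Θ X τ →
    ∀ θ ∈ Θ, X θ = M → IsMPositive p (curvatureMatrix X τ ν θ)

/-- The unit normal `ν` to `∂Ω` at `M` is interior: it looks into `Ω`. -/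
def IsInteriorNormal {n : ℕ} (Ω : Set (Euc (n + 1))) (M ν : Euc (n + 1)) : Prop :=
  IsUnitNormal (frontier Ω) M ν ∧ ∃ ε : ℝ, 0 < ε ∧ ∀ t : ℝ, 0 < t → t < ε → M + t • ν ∈ Ω

/-- The boundary of `Ω`, oriented by the interior normal, is `p`-convex at `M`. (The boundary of
a domain, when it is a `C²` hypersurface, has exactly one interior normal at each point.) -/
def BoundaryIsPConvexAt {n : ℕ} (p : ℕ) (Ω : Set (Euc (n + 1))) (M : Euc (n + 1)) : Prop :=
  ∃ ν, IsInteriorNormal Ω M ν ∧ IsPConvexAt p (frontier Ω) ν M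

/-! ### Kernels of local sub-barriers -/

/-- `D` is a domain `Ω_r`: `Ω_r ⊆ Ω ∩ B_r(M₀)` and `∂Ω_r ∩ ∂Ω = ∂Ω ∩ B_r(M₀)`. The equality is asked
for inside the open ball only: on the sphere `∂B_r(M₀)` the closed set `∂Ω_r` may, and in
general must, contain further points of `∂Ω`. -/
structure IsLocalDomain {k : ℕ} (Ω : Set (Euc k)) (M₀ : Euc k) (r : ℝ) (D : Set (Euc k)) :
    Prop where
  isOpen : IsOpen D
  isConnected : IsConnected D
  subset : D ⊆ Ω ∩ Metric.ball M₀ r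
  frontier_eq : frontier D ∩ frontier Ω ∩ Metric.ball M₀ r = frontier Ω ∩ Metric.ball M₀ r

/-- `W` is an `m`-Hessian kernel of local sub-barriers at `M₀ ∈ ∂Ω`. -/
def IsHessianKernel {k : ℕ} (m : ℕ) (Ω : Set (Euc k)) (M₀ : Euc k) (W : Euc k → ℝ) : Prop :=
  ∃ (r : ℝ) (D : Set (Euc k)), 0 < r ∧ IsLocalDomain Ω M₀ r D ∧ IsMAdmissible m D W ∧
    W M₀ = 0 ∧ (∀ x ∈ frontier D, W x ≤ 0) ∧ ∀ x ∈ frontier D ∩ Ω, W x ≤ -1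

end HessianKernel

namespace HessianKernel

open Polynomial Matrix

/-! ### Newton's inequality for real-rooted polynomials -/

/-! Let `W` be the kernel, `G` and `H` its extended gradient and Hessian, `ν` the normal at `M₀`
looking into `D`, and `K` the curvature matrix for `ν`. Since `m ≥ 1`, the trace of `H` is positive,
so the maximum principle gives `W ≤ 0` on the closure of `D`, and `M₀` is a maximum point. Hence the
derivative of `W` along `ν` is nonpositive, and the derivatives along the boundary vanish: `G = -κν`
with `κ ≥ 0`. The second derivative of `W` along boundary curves is nonpositive as well. In an
orthonormal tangent frame `E` this says that `κK - EᵀHE` is positive semidefinite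
(`isPConvexAt_of_admissible`).

The rest is algebra. Compressing an `m`-positive matrix to a hyperplane leaves it `(m - 1)`-positive
(`IsMPositive.compress`), and adding a positive semidefinite matrix preserves this
(`IsMPositive.add_posSemidef`). So `κK` is `(m - 1)`-positive, and `T_p(κK) = κ^p T_p(K)` with `κ ≥
0` gives the claim for `K`; no strict sign of `κ` is needed. Both cone properties are read off from
`det (1 + xS) = ∏ (1 + d_i x)`: they reduce to deleting one factor, which costs one order of
positivity by Newton's inequality (`coeff_pos_of_linear_mul`).

Two points need care at the boundary. `W` has derivatives there only as limits from `D`, so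
`second_order_test` shifts the curve into `D` and lets the shift tend to zero. That such a shift
exists is `exists_unitNormal_into`: as `W ≤ -1` on the part of `∂D` inside `Ω` while `W(M₀) = 0`,
near `M₀` the boundary of `D` lies in `∂Ω`, and `D` fills a whole side of a tube around it. -/

lemma splits_derivative {p : ℝ[X]} (hp : p.Splits) : (derivative p).Splits := by
  rcases Nat.eq_zero_or_pos p.natDegree with h | h
  · rw [natDegree_eq_zero.1 h |>.choose_spec.symm]
    simp
  · rw [splits_iff_card_roots] at hp ⊢
    have h1 := card_roots_le_derivative p
    have h2 := card_roots' (derivative p)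
    have h3 := natDegree_derivative_lt (p := p) (by omega)
    omega

/-- Away from the roots, `p'² - p p''` is `p²` times the sum of `(x - a)⁻²` over the roots `a`.
Induction on the roots avoids the division. -/
lemma eval_derivative_sq_ge_of_splits {p : ℝ[X]} (hp : p.Splits) (x : ℝ) :
    p.eval x * (derivative (derivative p)).eval x ≤ (derivative p).eval x ^ 2 := by
  obtain ⟨s, hs⟩ := splits_iff_exists_multiset.1 hp
  rw [hs]
  have key : ∀ s : Multiset ℝ, ((s.map (X - C ·)).prod).eval x *
      (derivative (derivative (s.map (X - C ·)).prod)).eval x ≤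
        (derivative (s.map (X - C ·)).prod).eval x ^ 2 := by
    intro s
    induction s using Multiset.induction_on with
    | empty => simp
    | cons a s ih =>
      rw [Multiset.map_cons, Multiset.prod_cons]
      set R := (s.map (X - C ·)).prod
      simp only [derivative_mul, derivative_add, eval_add, eval_mul, derivative_sub, derivative_X,
        derivative_C, eval_sub, eval_X, eval_C, sub_zero, one_mul]
      -- For `p = (X - a) R` the difference `p'² - p p''` equals `R² + (x - a)² (R'² - R R'')`.
      nlinarith [sq_nonneg (R.eval x), mul_nonneg (sq_nonneg (x - a)) (sub_nonneg.2 ih)]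
  simp only [derivative_C_mul, eval_mul, eval_C]
  nlinarith [mul_nonneg (sq_nonneg p.leadingCoeff) (sub_nonneg.2 (key s))]

/-- **Newton's inequality** for the coefficients of a real-rooted polynomial. -/
lemma newton_inequality {p : ℝ[X]} (hp : p.Splits) (k : ℕ) :
    (k + 2 : ℝ) * (p.coeff k * p.coeff (k + 2)) ≤ (k + 1) * p.coeff (k + 1) ^ 2 := by
  have hs : (derivative^[k] p).Splits := by
    induction k with
    | zero => exact hp
    | succ k ih => rw [Function.iterate_succ_apply']; exact splits_derivative ih
  have h := eval_derivative_sq_ge_of_splits hs 0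
  rw [← Function.iterate_succ_apply' (f := derivative),
    ← Function.iterate_succ_apply' (f := derivative)] at h
  simp only [← coeff_zero_eq_eval_zero, coeff_iterate_derivative, zero_add,
    Nat.descFactorial_self, nsmul_eq_mul] at h
  rw [Nat.factorial_succ (k + 1), Nat.factorial_succ k] at h
  push_cast at h
  -- At `0` the `k`-th derivative and its next two have the values `k! c_k`, `(k+1)! c_{k+1}`,
  -- `(k+2)! c_{k+2}`; this is their common factor.
  have hk : (0 : ℝ) < (k.factorial : ℝ) ^ 2 * (k + 1) := by positivity
  refine le_of_mul_le_mul_left ?_ hk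
  have e1 : (k : ℝ) + 1 + 1 = k + 2 := by ring
  rw [e1] at h
  calc _ = _ := ?_
    _ ≤ _ := h
    _ = _ := ?_
  · ring
  · ring

/-- Removing a linear factor from a real-rooted polynomial with positive low-order coefficients
leaves them positive up to one order less. -/
lemma coeff_pos_of_linear_mul {g : ℝ[X]} (hg : g.Splits) (a : ℝ) (m : ℕ)
    (h : ∀ p ≤ m, 0 < ((1 + C a * X) * g).coeff p) : ∀ p < m, 0 < g.coeff p := by
  have hc : ∀ p, ((1 + C a * X) * g).coeff (p + 1) = g.coeff (p + 1) + a * g.coeff p := by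
    intro p
    rw [add_mul, one_mul, coeff_add, mul_assoc, coeff_C_mul, coeff_X_mul]
  intro p
  induction p with
  | zero =>
    intro _
    simpa [add_mul, mul_assoc] using h 0 (Nat.zero_le _)
  | succ q ih =>
    intro hq
    have h0 := ih (by omega)
    have h1 := h (q + 1) (by omega)
    have h2 := h (q + 2) (by omega)
    rw [hc] at h1 h2
    have hN := newton_inequality hg q
    by_contra hneg
    push Not at hneg
    set x := g.coeff q
    set y := g.coeff (q + 1)
    set z := g.coeff (q + 1 + 1)
    have hq0 : (0 : ℝ) ≤ q := Nat.cast_nonneg q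
    -- If `y ≤ 0`, then `y + a x > 0` and `z + a y > 0` give `x z > -a x y ≥ y²`, against Newton.
    -- The use of order `q + 2` is what costs one order.
    have hzx : y ^ 2 < x * z := by
      nlinarith [mul_pos h0 h2, mul_nonneg (neg_nonneg.2 hneg) h1.le]
    nlinarith [sq_nonneg y, mul_pos (by positivity : (0:ℝ) < q + 2) (sub_pos.2 hzx)]

/-! ### The generating polynomial of the traces -/

variable {k : ℕ}

/-- The generating polynomial `det (1 + X S) = ∑ T_p(S) X ^ p` of the traces of `S`. -/
noncomputable def tracePoly (S : Matrix (Fin k) (Fin k) ℝ) : ℝ[X] :=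
  det (1 + (X : ℝ[X]) • S.map C)

lemma coeff_tracePoly (p : ℕ) (S : Matrix (Fin k) (Fin k) ℝ) :
    (tracePoly S).coeff p = pTrace p S :=
  coeff_det_one_add_X_smul_eq_sum_minors S p

lemma eval_tracePoly (x : ℝ) (S : Matrix (Fin k) (Fin k) ℝ) :
    (tracePoly S).eval x = det (1 + x • S) := by
  simp [tracePoly, eval_det, ← smul_eq_mul_diagonal]

lemma pTrace_one (S : Matrix (Fin k) (Fin k) ℝ) : pTrace 1 S = S.trace := by
  rw [← coeff_tracePoly, tracePoly, coeff_det_one_add_X_smul_one]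

/-- Sylvester's determinant identity. The factors may be rectangular, so a compression `Eᵀ S E` can
be traded for `S E Eᵀ`. -/
lemma tracePoly_mul_comm {l : ℕ} (A : Matrix (Fin k) (Fin l) ℝ) (B : Matrix (Fin l) (Fin k) ℝ) :
    tracePoly (A * B) = tracePoly (B * A) := by
  refine Polynomial.funext fun x => ?_
  rw [eval_tracePoly, eval_tracePoly, ← Matrix.smul_mul, det_one_add_mul_comm, Matrix.mul_smul]

lemma pTrace_smul (p : ℕ) (c : ℝ) (S : Matrix (Fin k) (Fin k) ℝ) :
    pTrace p (c • S) = c ^ p * pTrace p S := by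
  unfold pTrace
  rw [Finset.mul_sum]
  refine Finset.sum_congr rfl fun s hs => ?_
  change det (c • S.submatrix _ _) = _
  rw [det_smul, Fintype.card_coe, (Finset.mem_powersetCard.1 hs).2]

lemma tracePoly_diagonal (d : Fin k → ℝ) :
    tracePoly (diagonal d) = ∏ i, (1 + C (d i) * X) := by
  refine Polynomial.funext fun x => ?_
  rw [eval_tracePoly, ← diagonal_one, ← diagonal_smul, diagonal_add, det_diagonal, eval_prod]
  refine Finset.prod_congr rfl fun i _ => ?_
  simp only [eval_add, eval_one, eval_mul, eval_C, eval_X, Pi.smul_apply, smul_eq_mul]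
  ring

lemma exists_orthogonal_diagonalization {S : Matrix (Fin k) (Fin k) ℝ} (hS : S.IsSymm) :
    ∃ (U : Matrix (Fin k) (Fin k) ℝ) (d : Fin k → ℝ),
      Uᵀ * U = 1 ∧ S = U * diagonal d * Uᵀ := by
  have hH : S.IsHermitian := by rwa [IsHermitian, conjTranspose_eq_transpose_of_trivial]
  refine ⟨hH.eigenvectorUnitary, hH.eigenvalues, ?_, ?_⟩
  · have := Unitary.coe_star_mul_self hH.eigenvectorUnitary
    rwa [star_eq_conjTranspose, conjTranspose_eq_transpose_of_trivial] at this
  · have := hH.spectral_theorem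
    rwa [Unitary.conjStarAlgAut_apply, star_eq_conjTranspose,
      conjTranspose_eq_transpose_of_trivial] at this

/-- The matrix determinant lemma, with the inverse of the diagonal cleared so that the right side is
polynomial. -/
lemma det_diagonal_add_vecMulVec {d : Fin k → ℝ} (hd : ∀ i, d i ≠ 0) (u w : Fin k → ℝ) :
    det (diagonal d + vecMulVec u w) =
      ∏ i, d i + ∑ i, u i * w i * ∏ j ∈ Finset.univ.erase i, d j := by
  have hU : IsUnit (diagonal d).det := by
    rw [det_diagonal]; exact (Finset.prod_ne_zero_iff.2 fun i _ => hd i).isUnit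
  have hinv : (diagonal d)⁻¹ = diagonal fun i => (d i)⁻¹ := by
    refine inv_eq_left_inv ?_
    rw [diagonal_mul_diagonal, ← diagonal_one]
    congr 1; ext i; exact inv_mul_cancel₀ (hd i)
  rw [vecMulVec_eq Unit, det_add_replicateCol_mul_replicateRow hU, det_diagonal, hinv,
    det_unique (n := Unit),
    Matrix.add_apply, Matrix.one_apply_eq, mul_add, mul_one, Matrix.mul_apply, Finset.mul_sum]
  congr 1
  refine Finset.sum_congr rfl fun i _ => ?_
  rw [Matrix.mul_diagonal, replicateRow_apply, replicateCol_apply,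
    ← Finset.mul_prod_erase _ _ (Finset.mem_univ i)]
  field_simp [hd i]

lemma eq_of_eval_eq_of_eval_ne_zero {p q r : ℝ[X]} (hr : r ≠ 0)
    (h : ∀ x, r.eval x ≠ 0 → p.eval x = q.eval x) : p = q := by
  refine mul_left_cancel₀ hr (Polynomial.funext fun x => ?_)
  rw [eval_mul, eval_mul]
  by_cases hx : r.eval x = 0
  · rw [hx, zero_mul, zero_mul]
  · rw [h x hx]

lemma prod_one_add_C_mul_X_ne_zero (d : Fin k → ℝ) : ∏ i, (1 + C (d i) * X : ℝ[X]) ≠ 0 := by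
  intro h
  have := congrArg (eval 0) h
  simp [eval_prod] at this

/-- The generating polynomial under a rank one perturbation of a diagonal matrix. -/
lemma tracePoly_diagonal_add_smul (d w : Fin k → ℝ) (t : ℝ) :
    tracePoly (diagonal d + t • vecMulVec w w) = ∏ i, (1 + C (d i) * X) +
      X * ∑ i, C (t * w i ^ 2) * ∏ j ∈ Finset.univ.erase i, (1 + C (d j) * X) := by
  refine eq_of_eval_eq_of_eval_ne_zero (prod_one_add_C_mul_X_ne_zero d) fun x hx => ?_
  have hx' : ∀ i, 1 + x * d i ≠ 0 := by
    rw [eval_prod, Finset.prod_ne_zero_iff] at hx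
    intro i
    have := hx i (Finset.mem_univ i)
    simp only [eval_add, eval_one, eval_mul, eval_C, eval_X] at this
    rwa [mul_comm]
  have : 1 + x • (diagonal d + t • vecMulVec w w) =
      diagonal (fun i => 1 + x * d i) + vecMulVec ((x * t) • w) w := by
    ext i j
    by_cases hij : i = j
    · subst hij; simp [vecMulVec_apply]; ring
    · simp [vecMulVec_apply, hij]; ring
  rw [eval_tracePoly, this, det_diagonal_add_vecMulVec hx']
  simp only [eval_add, eval_mul, eval_X, eval_prod, eval_finsetSum, eval_C, eval_one,
    Finset.mul_sum, Pi.smul_apply, smul_eq_mul]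
  simp_rw [mul_comm x (d _)]
  congr 1
  refine Finset.sum_congr rfl fun i _ => ?_
  ring

/-- The generating polynomial of a diagonal matrix compressed to the hyperplane `w^⊥`. -/
lemma tracePoly_diagonal_mul_one_sub (d w : Fin k → ℝ) (hw : ∑ i, w i ^ 2 = 1) :
    tracePoly (diagonal d * (1 - vecMulVec w w)) =
      ∑ i, C (w i ^ 2) * ∏ j ∈ Finset.univ.erase i, (1 + C (d j) * X) := by
  refine eq_of_eval_eq_of_eval_ne_zero (prod_one_add_C_mul_X_ne_zero d) fun x hx => ?_
  have hx' : ∀ i, 1 + x * d i ≠ 0 := by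
    rw [eval_prod, Finset.prod_ne_zero_iff] at hx
    intro i
    have := hx i (Finset.mem_univ i)
    simp only [eval_add, eval_one, eval_mul, eval_C, eval_X] at this
    rwa [mul_comm]
  have : 1 + x • (diagonal d * (1 - vecMulVec w w)) =
      diagonal (fun i => 1 + x * d i) + vecMulVec (fun i => -(x * d i * w i)) w := by
    ext i j
    by_cases hij : i = j
    · subst hij; simp [vecMulVec_apply]; ring
    · simp [vecMulVec_apply, hij]; ring
  rw [eval_tracePoly, this, det_diagonal_add_vecMulVec hx']
  simp only [eval_add, eval_mul, eval_X, eval_prod, eval_finsetSum, eval_C, eval_one]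
  simp_rw [mul_comm (d _) x]
  have h1 : ∏ i, (1 + x * d i) = ∑ i, w i ^ 2 * ∏ i, (1 + x * d i) := by
    rw [← Finset.sum_mul, hw, one_mul]
  rw [h1, ← Finset.sum_add_distrib]
  refine Finset.sum_congr rfl fun i _ => ?_
  rw [← Finset.mul_prod_erase _ _ (Finset.mem_univ i)]
  ring

lemma splits_prod_one_add (s : Finset (Fin k)) (d : Fin k → ℝ) :
    (∏ j ∈ s, (1 + C (d j) * X : ℝ[X])).Splits := by
  refine Splits.prod fun i _ => ?_
  refine Splits.of_natDegree_le_one ?_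
  compute_degree

/-- If the first traces of a diagonal matrix are positive, then so are those of order one less
after removing an entry. -/
lemma coeff_prod_erase_pos {m : ℕ} {d : Fin k → ℝ}
    (h : ∀ p ≤ m, 0 < (∏ i, (1 + C (d i) * X : ℝ[X])).coeff p) (i : Fin k) :
    ∀ p < m, 0 < (∏ j ∈ Finset.univ.erase i, (1 + C (d j) * X : ℝ[X])).coeff p := by
  refine coeff_pos_of_linear_mul (splits_prod_one_add _ _) (d i) m fun p hp => ?_
  rw [Finset.mul_prod_erase _ (fun j => (1 + C (d j) * X : ℝ[X])) (Finset.mem_univ i)]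
  exact h p hp

/-! ### Stability of the cones of `m`-positive matrices -/

lemma tracePoly_conj {U : Matrix (Fin k) (Fin k) ℝ} (hU : Uᵀ * U = 1)
    (A : Matrix (Fin k) (Fin k) ℝ) : tracePoly (U * A * Uᵀ) = tracePoly A := by
  rw [tracePoly_mul_comm, ← Matrix.mul_assoc, hU, Matrix.one_mul]

/-- The cone of `m`-positive matrices is stable under adding a nonnegative rank one matrix. -/
lemma IsMPositive.add_vecMulVec {m : ℕ} {S : Matrix (Fin k) (Fin k) ℝ} (hS : IsMPositive m S)
    (v : Fin k → ℝ) : IsMPositive m (S + vecMulVec v v) := by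
  obtain ⟨hsymm, hpos⟩ := hS
  refine ⟨?_, fun p hp => ?_⟩
  · rw [IsSymm, transpose_add, hsymm.eq, transpose_vecMulVec]
  obtain ⟨U, d, hU, rfl⟩ := exists_orthogonal_diagonalization hsymm
  have hU' : U * Uᵀ = 1 := mul_eq_one_comm.1 hU
  have key : U * diagonal d * Uᵀ + vecMulVec v v =
      U * (diagonal d + (1 : ℝ) • vecMulVec (Uᵀ *ᵥ v) (Uᵀ *ᵥ v)) * Uᵀ := by
    rw [one_smul, Matrix.mul_add, Matrix.add_mul, mul_vecMulVec, vecMulVec_mul, mulVec_mulVec, hU',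
      one_mulVec, vecMul_transpose, mulVec_mulVec, hU', one_mulVec]
  simp_rw [← coeff_tracePoly, tracePoly_conj hU, tracePoly_diagonal] at hpos
  rw [← coeff_tracePoly, key, tracePoly_conj hU, tracePoly_diagonal_add_smul, coeff_add]
  refine add_pos_of_pos_of_nonneg (hpos p hp) ?_
  cases p with
  | zero => simp
  | succ p =>
    rw [coeff_X_mul, finsetSum_coeff]
    refine Finset.sum_nonneg fun i _ => ?_
    rw [coeff_C_mul]
    exact mul_nonneg (by positivity) (coeff_prod_erase_pos hpos i p (by omega)).le

/-- The cone of `m`-positive matrices is stable under adding a positive semidefinite matrix. -/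
lemma IsMPositive.add_posSemidef {m : ℕ} {S M : Matrix (Fin k) (Fin k) ℝ} (hS : IsMPositive m S)
    (hMs : M.IsSymm) (hM : ∀ v, 0 ≤ v ⬝ᵥ (M *ᵥ v)) : IsMPositive m (S + M) := by
  obtain ⟨U, d, hU, rfl⟩ := exists_orthogonal_diagonalization hMs
  have hd : ∀ i, 0 ≤ d i := by
    intro i
    have := hM (U *ᵥ Pi.single i 1)
    rw [mulVec_mulVec, Matrix.mul_assoc, hU, Matrix.mul_one, ← mulVec_mulVec, dotProduct_mulVec,
      ← mulVec_transpose, mulVec_mulVec, hU] at this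
    simpa using this
  have hsum : U * diagonal d * Uᵀ =
      ∑ i, vecMulVec (fun a => √(d i) * U a i) (fun a => √(d i) * U a i) := by
    ext a b
    rw [Matrix.mul_apply, Matrix.sum_apply]
    refine Finset.sum_congr rfl fun i _ => ?_
    rw [mul_diagonal, transpose_apply, vecMulVec_apply]
    linear_combination (-U a i * U b i) * Real.mul_self_sqrt (hd i)
  rw [hsum]
  generalize (Finset.univ : Finset (Fin k)) = s
  induction s using Finset.induction_on with
  | empty => simpa using hS
  | insert i s hi ih =>
    rw [Finset.sum_insert hi, add_comm (vecMulVec _ _), ← add_assoc]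
    exact ih.add_vecMulVec _

/-- The columns of `E` together with `w` form a square matrix with orthonormal columns; its left
inverse is also a right inverse. -/
lemma mul_transpose_eq_one_sub_of_orthonormal {n : ℕ} {E : Matrix (Fin (n + 1)) (Fin n) ℝ}
    {w : Fin (n + 1) → ℝ} (hE : Eᵀ * E = 1) (hw : w ⬝ᵥ w = 1) (hEw : Eᵀ *ᵥ w = 0) :
    E * Eᵀ = 1 - vecMulVec w w := by
  have h : (fromRows Eᵀ (replicateRow Unit w)) * (fromCols E (replicateCol Unit w)) = 1 := by
    rw [fromRows_mul_fromCols, hE, ← fromBlocks_one]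
    congr 1
    · ext i j
      simpa [Matrix.mul_apply, mulVec, dotProduct] using congrFun hEw i
    · ext i j
      simpa [Matrix.mul_apply, mulVec, dotProduct, mul_comm] using congrFun hEw j
    · ext i j
      simpa [Matrix.mul_apply, dotProduct] using hw
  have h2 := (mul_eq_one_comm_of_card_eq _ _ _ (by simp)).1 h
  rw [fromCols_mul_fromRows] at h2
  rw [vecMulVec_eq Unit]
  exact eq_sub_of_add_eq h2

/-- The compression of an `m`-positive matrix to a hyperplane is `(m - 1)`-positive. -/
lemma IsMPositive.compress {m n : ℕ} {S : Matrix (Fin (n + 1)) (Fin (n + 1)) ℝ}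
    (hS : IsMPositive m S) (hm : 1 ≤ m) {E : Matrix (Fin (n + 1)) (Fin n) ℝ}
    {w : Fin (n + 1) → ℝ} (hE : Eᵀ * E = 1) (hw : w ⬝ᵥ w = 1) (hEw : Eᵀ *ᵥ w = 0) :
    IsMPositive (m - 1) (Eᵀ * S * E) := by
  obtain ⟨hsymm, hpos⟩ := hS
  refine ⟨?_, fun p hp => ?_⟩
  · rw [IsSymm, transpose_mul, transpose_mul, transpose_transpose, hsymm.eq, Matrix.mul_assoc]
  obtain ⟨U, d, hU, rfl⟩ := exists_orthogonal_diagonalization hsymm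
  have hU' : U * Uᵀ = 1 := mul_eq_one_comm.1 hU
  simp_rw [← coeff_tracePoly, tracePoly_conj hU, tracePoly_diagonal] at hpos
  set z := Uᵀ *ᵥ w with hz
  have hz1 : ∑ i, z i ^ 2 = 1 := by
    have : z ⬝ᵥ z = 1 := by
      rw [hz, dotProduct_mulVec, vecMul_transpose, mulVec_mulVec, hU', one_mulVec, hw]
    rw [← this, dotProduct]
    exact Finset.sum_congr rfl fun i _ => sq _
  have key : Uᵀ * (1 - vecMulVec w w) * U = 1 - vecMulVec z z := by
    rw [Matrix.mul_sub, Matrix.sub_mul, Matrix.mul_one, hU, mul_vecMulVec, vecMulVec_mul,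
      ← mulVec_transpose]
  -- Cyclic permutation produces `E Eᵀ`, the projection onto the hyperplane orthogonal to `w`, which
  -- in the eigenbasis becomes `1 - z zᵀ`.
  have hpoly : tracePoly (Eᵀ * (U * diagonal d * Uᵀ) * E) =
      tracePoly (diagonal d * (1 - vecMulVec z z)) := by
    rw [Matrix.mul_assoc, tracePoly_mul_comm, Matrix.mul_assoc,
      mul_transpose_eq_one_sub_of_orthonormal hE hw hEw, ← key, Matrix.mul_assoc, Matrix.mul_assoc,
      tracePoly_mul_comm]
    simp only [Matrix.mul_assoc]
  rw [← coeff_tracePoly, hpoly, tracePoly_diagonal_mul_one_sub _ _ hz1, finsetSum_coeff]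
  simp_rw [coeff_C_mul]
  have hc := fun i => coeff_prod_erase_pos hpos i p (by omega)
  -- Each coefficient is an average, with weights `z i ^ 2`, of positive ones; strictness needs one
  -- nonzero weight.
  obtain ⟨i, hi⟩ : ∃ i, z i ≠ 0 := by
    by_contra! h
    simp [h] at hz1
  exact Finset.sum_pos' (fun i _ => mul_nonneg (sq_nonneg _) (hc i).le)
    ⟨i, Finset.mem_univ i, mul_pos (by positivity) (hc i)⟩

end HessianKernel

namespace HessianKernel

open Matrix Filter Topology Set

/-! ### Second order conditions at the boundary -/

/-- Taylor's bound by two uses of monotonicity; `h₂` need not be continuous. -/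
lemma quadratic_lower_bound_of_nonneg {h h₁ h₂ : ℝ → ℝ} {η a : ℝ}
    (d1 : ∀ t, |t| < η → HasDerivAt h (h₁ t) t) (d2 : ∀ t, |t| < η → HasDerivAt h₁ (h₂ t) t)
    (ha : ∀ t, |t| < η → a ≤ h₂ t) {t : ℝ} (ht : |t| < η) (ht0 : 0 ≤ t) :
    h 0 + h₁ 0 * t + a * t ^ 2 / 2 ≤ h t := by
  have hmem : ∀ s ∈ Icc 0 t, |s| < η := fun s hs => by
    rw [abs_of_nonneg hs.1]; rw [abs_of_nonneg ht0] at ht; exact hs.2.trans_lt ht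
  have e1 : ∀ s ∈ Icc 0 t, HasDerivAt (fun s => h₁ s - a * s) (h₂ s - a) s := fun s hs => by
    exact ((d2 s (hmem s hs)).sub ((hasDerivAt_id s).const_mul a)).congr_deriv (by simp)
  have m1 : MonotoneOn (fun s => h₁ s - a * s) (Icc 0 t) :=
    monotoneOn_of_hasDerivWithinAt_nonneg (f' := fun s => h₂ s - a) (convex_Icc _ _)
      (fun s hs => (e1 s hs).continuousAt.continuousWithinAt)
      (fun s hs => (e1 s (interior_subset hs)).hasDerivWithinAt)
      (fun s hs => sub_nonneg.2 (ha s (hmem s (interior_subset hs))))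
  have e2 : ∀ s ∈ Icc 0 t, HasDerivAt (fun s => h s - h₁ 0 * s - a * s ^ 2 / 2)
      (h₁ s - h₁ 0 - a * s) s := fun s hs => by
    have := ((d1 s (hmem s hs)).sub ((hasDerivAt_id s).const_mul (h₁ 0))).sub
      ((((hasDerivAt_id s).pow 2).const_mul a).div_const 2)
    refine this.congr_deriv ?_
    simp
    ring
  have m2 : MonotoneOn (fun s => h s - h₁ 0 * s - a * s ^ 2 / 2) (Icc 0 t) :=
    monotoneOn_of_hasDerivWithinAt_nonneg (f' := fun s => h₁ s - h₁ 0 - a * s) (convex_Icc _ _)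
      (fun s hs => (e2 s hs).continuousAt.continuousWithinAt)
      (fun s hs => (e2 s (interior_subset hs)).hasDerivWithinAt)
      (fun s hs => by
        have := m1 (left_mem_Icc.2 ht0) (interior_subset hs) (interior_subset hs).1
        simp only at this
        linarith)
  have := m2 (left_mem_Icc.2 ht0) (right_mem_Icc.2 ht0) ht0
  simp only at this
  linarith

lemma quadratic_lower_bound {h h₁ h₂ : ℝ → ℝ} {η a : ℝ}
    (d1 : ∀ t, |t| < η → HasDerivAt h (h₁ t) t) (d2 : ∀ t, |t| < η → HasDerivAt h₁ (h₂ t) t)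
    (ha : ∀ t, |t| < η → a ≤ h₂ t) {t : ℝ} (ht : |t| < η) :
    h 0 + h₁ 0 * t + a * t ^ 2 / 2 ≤ h t := by
  rcases le_total 0 t with h0 | h0
  · exact quadratic_lower_bound_of_nonneg d1 d2 ha ht h0
  · have := quadratic_lower_bound_of_nonneg (h := fun t => h (-t)) (h₁ := fun t => -h₁ (-t))
      (h₂ := fun t => h₂ (-t)) (η := η) (a := a) (t := -t)
      (fun s hs => by
        exact ((d1 (-s) (by rwa [abs_neg])).comp s (hasDerivAt_neg s)).congr_deriv (by simp))
      (fun s hs => by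
        exact ((d2 (-s) (by rwa [abs_neg])).comp s (hasDerivAt_neg s)).neg.congr_deriv (by simp))
      (fun s hs => ha (-s) (by rwa [abs_neg])) (by rwa [abs_neg]) (by linarith)
    simpa using this

lemma fderiv_apply_eq_sum {k : ℕ} {F : Type*} [NormedAddCommGroup F] [NormedSpace ℝ F]
    (f : Euc k → F) (x v : Euc k) : fderiv ℝ f x v = ∑ i, v i • pderiv i f x := by
  have hv : v = ∑ i, v i • EuclideanSpace.single i (1 : ℝ) := by
    ext j
    simp [Finset.sum_apply, Pi.single_apply]
  conv_lhs => rw [hv]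
  simp [pderiv, map_sum]

lemma differentiableAt_pderiv {k : ℕ} {F : Type*} [NormedAddCommGroup F] [NormedSpace ℝ F]
    {f : Euc k → F} {D : Set (Euc k)} (hD : IsOpen D) (hf : ContDiffOn ℝ 2 f D) {x : Euc k}
    (hx : x ∈ D) (i : Fin k) : DifferentiableAt ℝ (pderiv i f) x := by
  have h1 : ContDiffAt ℝ 1 (fderiv ℝ f) x :=
    (hf.contDiffAt (hD.mem_nhds hx)).fderiv_right (by norm_num)
  exact (h1.differentiableAt (by norm_num)).clm_apply (differentiableAt_const _)

variable {k : ℕ} {D : Set (Euc k)} {W : Euc k → ℝ} {G : Euc k → Fin k → ℝ}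
  {H : Euc k → Matrix (Fin k) (Fin k) ℝ}

lemma IsC2UpToBoundary.hasDerivAt_comp (hD : IsOpen D) (hW : IsC2UpToBoundary D W G H)
    {c : ℝ → Euc k} {c' : Euc k} {t : ℝ} (hc : HasDerivAt c c' t) (ht : c t ∈ D) :
    HasDerivAt (fun t => W (c t)) (G (c t) ⬝ᵥ c'.ofLp) t := by
  have hd := ((hW.contDiffOn.contDiffAt (hD.mem_nhds ht)).differentiableAt
    (by norm_num)).hasFDerivAt.comp_hasDerivAt t hc
  refine hd.congr_deriv ?_
  rw [fderiv_apply_eq_sum, dotProduct]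
  exact Finset.sum_congr rfl fun i _ => by rw [hW.grad_eq _ ht, smul_eq_mul, mul_comm]

lemma IsC2UpToBoundary.hasDerivAt_grad_comp (hD : IsOpen D) (hW : IsC2UpToBoundary D W G H)
    {c c₁ : ℝ → Euc k} {c₂ : Euc k} {t : ℝ} (hc : HasDerivAt c (c₁ t) t) (ht : c t ∈ D)
    (hc₁ : HasDerivAt c₁ c₂ t) :
    HasDerivAt (fun t => G (c t) ⬝ᵥ (c₁ t).ofLp)
      ((c₁ t).ofLp ⬝ᵥ (H (c t) *ᵥ (c₁ t).ofLp) + G (c t) ⬝ᵥ c₂.ofLp) t := by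
  have hG : ∀ i, HasDerivAt (fun t => G (c t) i) (∑ j, c₁ t j * H (c t) j i) t := fun i => by
    have hd := (differentiableAt_pderiv hD hW.contDiffOn ht i).hasFDerivAt.comp_hasDerivAt t hc
    have he : (fun t => G (c t) i) =ᶠ[𝓝 t] pderiv i W ∘ c := by
      filter_upwards [hc.continuousAt.preimage_mem_nhds (hD.mem_nhds ht)] with s hs
      exact hW.grad_eq _ hs i
    refine (hd.congr_of_eventuallyEq he).congr_deriv ?_
    rw [fderiv_apply_eq_sum, hW.hess_eq _ ht]
    rfl
  have hv : ∀ i, HasDerivAt (fun t => (c₁ t).ofLp i) (c₂.ofLp i) t := fun i =>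
    (EuclideanSpace.proj i : Euc k →L[ℝ] ℝ).hasFDerivAt.comp_hasDerivAt t hc₁
  have := HasDerivAt.fun_sum (u := Finset.univ) fun i _ => (hG i).mul (hv i)
  refine this.congr_deriv ?_
  simp only [dotProduct, mulVec, Finset.sum_add_distrib, Finset.sum_mul, Finset.mul_sum]
  rw [Finset.sum_comm]
  simp only [mul_assoc]

/-- Along a curve from which one may move into `D` in the direction `ν`, a function of class
`C²(D̄)` satisfies the necessary conditions for a maximum. -/
lemma IsC2UpToBoundary.second_order_test (hD : IsOpen D) (hW : IsC2UpToBoundary D W G H)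
    {γ γ₁ γ₂ : ℝ → Euc k} {ν : Euc k} {η : ℝ} (hη : 0 < η)
    (hγ : ∀ t, |t| < η → HasDerivAt γ (γ₁ t) t) (hγ₁ : ∀ t, |t| < η → HasDerivAt γ₁ (γ₂ t) t)
    (hγ₂ : ContinuousAt γ₂ 0) (hin : ∀ t s, |t| < η → 0 < s → s < η → γ t + s • ν ∈ D)
    (hmax : ∀ t, |t| < η → W (γ t) ≤ W (γ 0)) :
    G (γ 0) ⬝ᵥ (γ₁ 0).ofLp = 0 ∧
      (γ₁ 0).ofLp ⬝ᵥ (H (γ 0) *ᵥ (γ₁ 0).ofLp) + G (γ 0) ⬝ᵥ (γ₂ 0).ofLp ≤ 0 := by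
  have hη0 : |(0 : ℝ)| < η := by simpa
  have hlim : ∀ t, Tendsto (fun s : ℝ => γ t + s • ν) (𝓝[>] 0) (𝓝 (γ t)) := fun t => by
    have : Continuous fun s : ℝ => γ t + s • ν := by fun_prop
    have h := this.tendsto 0
    rw [zero_smul, add_zero] at h
    exact h.mono_left nhdsWithin_le_nhds
  have hlimD : ∀ t, |t| < η → Tendsto (fun s : ℝ => γ t + s • ν) (𝓝[>] 0) (𝓝[closure D] (γ t)) :=
    fun t ht => tendsto_nhdsWithin_iff.2 ⟨hlim t, by
      filter_upwards [Ioo_mem_nhdsGT hη] with s hs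
      exact subset_closure (hin t s ht hs.1 hs.2)⟩
  have hcl : ∀ t, |t| < η → γ t ∈ closure D := fun t ht =>
    mem_closure_of_tendsto (hlim t) (by
      filter_upwards [Ioo_mem_nhdsGT hη] with s hs
      exact hin t s ht hs.1 hs.2)
  set L := G (γ 0) ⬝ᵥ (γ₁ 0).ofLp with hL
  set q₀ := (γ₁ 0).ofLp ⬝ᵥ (H (γ 0) *ᵥ (γ₁ 0).ofLp) + G (γ 0) ⬝ᵥ (γ₂ 0).ofLp with hq₀
  -- a lower quadratic bound with any constant smaller than the second derivative
  have key : ∀ a < q₀, ∃ η' > 0, ∀ t, |t| < η' → L * t + a * t ^ 2 / 2 ≤ 0 := by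
    intro a ha
    -- The bound on the second derivative must be uniform in the shift `s`, so the limit is taken in
    -- `(t, s)` jointly, over pairs whose shifted point lies in `D`.
    set S : Set (ℝ × ℝ) := {p | |p.1| < η ∧ 0 < p.2 ∧ p.2 < η}
    have t1 : Tendsto (fun p : ℝ × ℝ => γ p.1) (𝓝[S] (0, 0)) (𝓝 (γ 0)) :=
      ((hγ 0 hη0).continuousAt.comp_of_eq continuousAt_fst rfl).mono_left nhdsWithin_le_nhds
    have t2 : Tendsto (fun p : ℝ × ℝ => γ₁ p.1) (𝓝[S] (0, 0)) (𝓝 (γ₁ 0)) :=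
      ((hγ₁ 0 hη0).continuousAt.comp_of_eq continuousAt_fst rfl).mono_left nhdsWithin_le_nhds
    have t3 : Tendsto (fun p : ℝ × ℝ => γ₂ p.1) (𝓝[S] (0, 0)) (𝓝 (γ₂ 0)) :=
      (hγ₂.comp_of_eq continuousAt_fst rfl).mono_left nhdsWithin_le_nhds
    have t4 : Tendsto (fun p : ℝ × ℝ => γ p.1 + p.2 • ν) (𝓝[S] (0, 0)) (𝓝[closure D] (γ 0)) := by
      refine tendsto_nhdsWithin_iff.2 ⟨?_, ?_⟩
      · have : Tendsto (fun p : ℝ × ℝ => p.2 • ν) (𝓝[S] (0, 0)) (𝓝 ((0 : ℝ) • ν)) :=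
          (Continuous.tendsto (by fun_prop : Continuous fun p : ℝ × ℝ => p.2 • ν)
            (0, 0)).mono_left nhdsWithin_le_nhds
        simpa using t1.add this
      · filter_upwards [self_mem_nhdsWithin] with p hp
        exact subset_closure (hin _ _ hp.1 hp.2.1 hp.2.2)
    have tG := (hW.continuousOn_grad _ (hcl 0 hη0)).tendsto.comp t4
    have tH := (hW.continuousOn_hess _ (hcl 0 hη0)).tendsto.comp t4
    have hΦ : Continuous fun z : Euc k × Euc k × (Fin k → ℝ) × Matrix (Fin k) (Fin k) ℝ =>
        z.1.ofLp ⬝ᵥ (z.2.2.2 *ᵥ z.1.ofLp) + z.2.2.1 ⬝ᵥ z.2.1.ofLp := by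
      fun_prop
    have hQ := (hΦ.tendsto (γ₁ 0, γ₂ 0, G (γ 0), H (γ 0))).comp
      (t2.prodMk_nhds (t3.prodMk_nhds (tG.prodMk_nhds tH)))
    have hev := hQ.eventually (lt_mem_nhds ha)
    rw [eventually_nhdsWithin_iff, Metric.eventually_nhds_iff] at hev
    obtain ⟨ε, hε, hev⟩ := hev
    refine ⟨min η ε, lt_min hη hε, fun t ht => ?_⟩
    have hineq : ∀ s, 0 < s → s < min η ε →
        W (γ 0 + s • ν) + (G (γ 0 + s • ν) ⬝ᵥ (γ₁ 0).ofLp) * t + a * t ^ 2 / 2 ≤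
          W (γ t + s • ν) := by
      intro s hs0 hs
      have hsη := hs.trans_le (min_le_left _ _)
      refine quadratic_lower_bound (h := fun t => W (γ t + s • ν))
        (h₁ := fun t => G (γ t + s • ν) ⬝ᵥ (γ₁ t).ofLp)
        (h₂ := fun t => (γ₁ t).ofLp ⬝ᵥ (H (γ t + s • ν) *ᵥ (γ₁ t).ofLp) +
          G (γ t + s • ν) ⬝ᵥ (γ₂ t).ofLp) (η := min η ε) ?_ ?_ ?_ ht
      · intro u hu
        have hu' := hu.trans_le (min_le_left _ _)
        exact hW.hasDerivAt_comp hD (c := fun t => γ t + s • ν) ((hγ u hu').add_const _)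
          (hin u s hu' hs0 hsη)
      · intro u hu
        have hu' := hu.trans_le (min_le_left _ _)
        exact hW.hasDerivAt_grad_comp hD (c := fun t => γ t + s • ν) ((hγ u hu').add_const _)
          (hin u s hu' hs0 hsη) (hγ₁ u hu')
      · intro u hu
        refine (hev (y := (u, s)) ?_ ⟨hu.trans_le (min_le_left _ _), hs0, hsη⟩).le
        rw [Prod.dist_eq]
        refine max_lt ?_ ?_
        · simpa using hu.trans_le (min_le_right _ _)
        · simpa [abs_of_pos hs0] using hs.trans_le (min_le_right _ _)
    have htη : |t| < η := ht.trans_le (min_le_left _ _)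
    have l1 := (hW.continuousOn _ (hcl 0 hη0)).tendsto.comp (hlimD 0 hη0)
    have l2 := (hW.continuousOn _ (hcl t htη)).tendsto.comp (hlimD t htη)
    have l3 := (hW.continuousOn_grad _ (hcl 0 hη0)).tendsto.comp (hlimD 0 hη0)
    have l4 : Tendsto (fun s : ℝ => G (γ 0 + s • ν) ⬝ᵥ (γ₁ 0).ofLp) (𝓝[>] 0) (𝓝 L) :=
      ((by fun_prop : Continuous fun g : Fin k → ℝ => g ⬝ᵥ (γ₁ 0).ofLp).tendsto _).comp l3
    have hle := le_of_tendsto_of_tendsto ((l1.add (l4.mul_const t)).add_const (a * t ^ 2 / 2)) l2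
      (by
        filter_upwards [Ioo_mem_nhdsGT (lt_min hη hε)] with s hs
        exact hineq s hs.1 hs.2)
    linarith [hmax t htη]
  -- A nonzero slope would dominate the quadratic term for small `t` of one sign; any constant below
  -- `q₀` serves.
  have hL0 : L = 0 := by
    obtain ⟨η', hη', h⟩ := key (q₀ - 1) (by linarith)
    have step : ∀ σ : ℝ, |σ| = 1 → L * σ ≤ 0 := by
      intro σ hσ
      have hlin : Tendsto (fun t : ℝ => L * σ + (q₀ - 1) * t / 2) (𝓝[>] 0) (𝓝 (L * σ)) := by
        have : Continuous fun t : ℝ => L * σ + (q₀ - 1) * t / 2 := by fun_prop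
        have h := this.tendsto 0
        rw [mul_zero, zero_div, add_zero] at h
        exact h.mono_left nhdsWithin_le_nhds
      refine le_of_tendsto hlin ?_
      filter_upwards [Ioo_mem_nhdsGT hη'] with t ht
      have h1 := h (σ * t) (by rw [abs_mul, hσ, one_mul, abs_of_pos ht.1]; exact ht.2)
      have hσ2 : σ ^ 2 = 1 := by rw [← sq_abs, hσ, one_pow]
      have h2 : t * (L * σ + (q₀ - 1) * t / 2) ≤ 0 := by
        rw [mul_pow, hσ2] at h1; linarith
      exact nonpos_of_mul_nonpos_right h2 ht.1
    have h1 := step 1 (by simp)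
    have h2 := step (-1) (by simp)
    linarith
  refine ⟨hL0, ?_⟩
  by_contra! hq
  obtain ⟨η', hη', h⟩ := key (q₀ / 2) (by linarith)
  have := h (η' / 2) (by rw [abs_of_pos (by linarith)]; linarith)
  rw [hL0] at this
  have : 0 < q₀ / 2 * (η' / 2) ^ 2 / 2 := by positivity
  linarith

/-! ### The maximum principle and the sign of the normal derivative -/

/-- The weak maximum principle. -/
lemma IsC2UpToBoundary.le_zero_of_frontier (hD : IsOpen D) (hb : Bornology.IsBounded D)
    (hW : IsC2UpToBoundary D W G H) (hH : ∀ x ∈ closure D, 0 < (H x).trace)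
    (hfr : ∀ x ∈ frontier D, W x ≤ 0) : ∀ x ∈ closure D, W x ≤ 0 := by
  intro x hx
  obtain ⟨y, hy, hmax⟩ := hb.isCompact_closure.exists_isMaxOn ⟨x, hx⟩ hW.continuousOn
  refine (hmax hx).trans ?_
  by_cases hyD : y ∈ D
  · exfalso
    have hdiag : ∀ i, H y i i ≤ 0 := by
      intro i
      have hc : ContinuousAt (fun t : ℝ => y + t • EuclideanSpace.single i (1 : ℝ)) 0 := by
        fun_prop
      have hnhds : ∀ᶠ t : ℝ in 𝓝 0, y + t • EuclideanSpace.single i (1 : ℝ) ∈ D :=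
        hc.preimage_mem_nhds (hD.mem_nhds (by simpa using hyD))
      obtain ⟨η, hη, hηD⟩ := Metric.eventually_nhds_iff.1 hnhds
      have hηD' : ∀ t : ℝ, |t| < η → y + t • EuclideanSpace.single i (1 : ℝ) ∈ D := fun t ht =>
        hηD (by simpa using ht)
      -- The maximum is interior, so no shift is needed (`ν := 0`), and on a straight line the
      -- gradient term vanishes.
      have := (hW.second_order_test hD (γ := fun t : ℝ => y + t • EuclideanSpace.single i (1 : ℝ))
        (γ₁ := fun _ => EuclideanSpace.single i (1 : ℝ)) (γ₂ := fun _ => 0) (ν := 0) hη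
        (fun t _ => by
          simpa using ((hasDerivAt_id t).smul_const (EuclideanSpace.single i (1 : ℝ))).const_add y)
        (fun t _ => hasDerivAt_const _ _) continuousAt_const
        (fun t s ht _ _ => by simpa using hηD' t ht)
        (fun t ht => by simpa using hmax (subset_closure (hηD' t ht)))).2
      simpa using this
    exact absurd (hH y hy) (not_lt.2 (Finset.sum_nonpos fun i _ => hdiag i))
  · exact hfr y (by rw [frontier, hD.interior_eq]; exact ⟨hy, hyD⟩)

/-- At a boundary point where a nonpositive function vanishes, the derivative in a direction
leading into `D` is nonpositive. -/
lemma IsC2UpToBoundary.grad_dotProduct_nonpos (hD : IsOpen D) (hW : IsC2UpToBoundary D W G H)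
    (hle : ∀ x ∈ D, W x ≤ 0) {M ν : Euc k} (hM : M ∈ closure D) (hWM : W M = 0) {ρ : ℝ}
    (hρ : 0 < ρ) (hin : ∀ s, 0 < s → s < ρ → M + s • ν ∈ D) : G M ⬝ᵥ ν.ofLp ≤ 0 := by
  have hlim : Tendsto (fun s : ℝ => M + s • ν) (𝓝[>] 0) (𝓝[closure D] M) := by
    refine tendsto_nhdsWithin_iff.2 ⟨?_, ?_⟩
    · have h := (by fun_prop : Continuous fun s : ℝ => M + s • ν).tendsto 0
      rw [zero_smul, add_zero] at h
      exact h.mono_left nhdsWithin_le_nhds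
    · filter_upwards [Ioo_mem_nhdsGT hρ] with s hs
      exact subset_closure (hin s hs.1 hs.2)
  have hG : Tendsto (fun s : ℝ => G (M + s • ν) ⬝ᵥ ν.ofLp) (𝓝[>] 0) (𝓝 (G M ⬝ᵥ ν.ofLp)) :=
    ((by fun_prop : Continuous fun g : Fin k → ℝ => g ⬝ᵥ ν.ofLp).tendsto _).comp
      ((hW.continuousOn_grad _ hM).tendsto.comp hlim)
  by_contra! hpos
  obtain ⟨ε, hε, hεpos⟩ := mem_nhdsGT_iff_exists_Ioo_subset.1 (hG.eventually (lt_mem_nhds hpos))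
  have hε : 0 < ε := hε
  set s₀ := min ε ρ / 2
  have hs₀ : 0 < s₀ := by have := lt_min hε hρ; positivity
  have hs₀' : s₀ < min ε ρ := half_lt_self (lt_min hε hρ)
  have hd : ∀ s ∈ Ioc 0 s₀, HasDerivAt (fun s => W (M + s • ν)) (G (M + s • ν) ⬝ᵥ ν.ofLp) s :=
    fun s hs => hW.hasDerivAt_comp hD (c := fun s => M + s • ν)
      (by simpa using ((hasDerivAt_id s).smul_const ν).const_add M)
      (hin s hs.1 (hs.2.trans_lt (hs₀'.trans_le (min_le_right _ _))))
  have hcont : ContinuousOn (fun s => W (M + s • ν)) (Icc 0 s₀) := by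
    intro s hs
    rcases hs.1.eq_or_lt with rfl | h0
    · refine ContinuousWithinAt.mono ?_ Icc_subset_Ici_self
      rw [← continuousWithinAt_Ioi_iff_Ici]
      have := (hW.continuousOn _ hM).tendsto.comp hlim
      simpa [ContinuousWithinAt, Function.comp_def] using this
    · exact (hd s ⟨h0, hs.2⟩).continuousAt.continuousWithinAt
  -- By the mean value theorem some derivative near `M` equals `W (M + s₀ • ν) / s₀ ≤ 0`, against
  -- positivity there.
  obtain ⟨c, hc, hc'⟩ := exists_hasDerivAt_eq_slope _ _ hs₀ hcont fun s hs => hd s ⟨hs.1, hs.2.le⟩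
  have h1 : 0 < G (M + c • ν) ⬝ᵥ ν.ofLp :=
    hεpos ⟨hc.1, hc.2.trans (hs₀'.trans_le (min_le_left _ _))⟩
  have h2 := hle _ (hin s₀ hs₀ (hs₀'.trans_le (min_le_right _ _)))
  rw [hc', zero_smul, add_zero, hWM, sub_zero, sub_zero] at h1
  exact absurd h1 (not_lt.2 (div_nonpos_of_nonpos_of_nonneg h2 hs₀.le))

end HessianKernel

namespace HessianKernel

open Matrix Filter Topology Set

/-! ### Local structure of a hypersurface -/

variable {n : ℕ} {Γ : Set (Euc (n + 1))} {M : Euc (n + 1)} {Θ : Set (Euc n)}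
  {X : Euc n → Euc (n + 1)} {θ₀ : Euc n}

lemma IsLocalParam.mem (h : IsLocalParam Γ M Θ X) {θ : Euc n} (hθ : θ ∈ Θ) : X θ ∈ Γ := by
  obtain ⟨r, -, hr⟩ := h.image_eq
  exact (hr.subset (mem_image_of_mem X hθ)).1

lemma IsLocalParam.contDiffAt (h : IsLocalParam Γ M Θ X) {θ : Euc n} (hθ : θ ∈ Θ) :
    ContDiffAt ℝ 2 X θ :=
  h.contDiffOn.contDiffAt (h.isOpen.mem_nhds hθ)

lemma exists_unit_orthogonal (b : Fin n → Euc (n + 1)) :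
    ∃ ν : Euc (n + 1), ‖ν‖ = 1 ∧ ∀ j, inner ℝ (b j) ν = 0 := by
  set K := Submodule.span ℝ (range b)
  have hK : Kᗮ ≠ ⊥ := by
    intro h
    rw [Submodule.orthogonal_eq_bot_iff] at h
    have h1 : Module.finrank ℝ K ≤ n := by
      simpa [Set.finrank] using finrank_range_le_card (R := ℝ) b
    rw [h, finrank_top, finrank_euclideanSpace_fin] at h1
    omega
  obtain ⟨w, hw, hw0⟩ := Submodule.exists_mem_ne_zero_of_ne_bot hK
  refine ⟨(‖w‖⁻¹ : ℝ) • w, norm_smul_inv_norm hw0, fun j => ?_⟩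
  rw [inner_smul_right, hw _ (Submodule.subset_span (mem_range_self j)), mul_zero]

/-- The metric tensor is the Gram matrix of the tangent vectors, so its nondegeneracy makes them
independent. -/
lemma IsLocalParam.fderiv_injective (h : IsLocalParam Γ M Θ X) (hθ₀ : θ₀ ∈ Θ) {v : Euc n}
    (hv : fderiv ℝ X θ₀ v = 0) : v = 0 := by
  have hmul : metricTensor X θ₀ *ᵥ v.ofLp = 0 := by
    ext j
    have : inner ℝ (pderiv j X θ₀) (fderiv ℝ X θ₀ v) = 0 := by rw [hv, inner_zero_right]
    rw [fderiv_apply_eq_sum, inner_sum] at this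
    simp only [inner_smul_right] at this
    simp only [mulVec, dotProduct, metricTensor, of_apply, Pi.zero_apply]
    rw [← this]
    exact Finset.sum_congr rfl fun i _ => mul_comm _ _
  have := eq_zero_of_mulVec_eq_zero (h.det_ne_zero θ₀ hθ₀) hmul
  ext i
  exact congrFun this i

/-- Points of `Γ` near `X θ₀` have parameters near `θ₀`. -/
lemma IsLocalParam.eventually_exists (h : IsLocalParam Γ M Θ X) (hθ₀ : θ₀ ∈ Θ) (hX : X θ₀ = M)
    {V : Set (Euc n)} (hV : V ∈ 𝓝 θ₀) :
    ∀ᶠ x in 𝓝 M, x ∈ Γ → ∃ θ ∈ Θ, θ ∈ V ∧ X θ = x := by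
  obtain ⟨r, hr, himg⟩ := h.image_eq
  have h1 : (Subtype.val ⁻¹' V : Set Θ) ∈ 𝓝 (⟨θ₀, hθ₀⟩ : Θ) :=
    continuous_subtype_val.continuousAt.preimage_mem_nhds hV
  rw [h.isEmbedding.isInducing.nhds_eq_comap, mem_comap] at h1
  obtain ⟨t, ht, hts⟩ := h1
  simp only [hX] at ht
  filter_upwards [ht, Metric.ball_mem_nhds M hr] with x hx hxr hxΓ
  obtain ⟨θ, hθ, rfl⟩ := himg.superset ⟨hxΓ, hxr⟩
  exact ⟨θ, hθ, @hts ⟨θ, hθ⟩ hx, rfl⟩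

/-- The differential of the normal coordinates `(θ, s) ↦ X θ + s ν`. -/
lemma IsLocalParam.exists_normal_coordinates (h : IsLocalParam Γ M Θ X) (hθ₀ : θ₀ ∈ Θ)
    {ν : Euc (n + 1)} (hν : ‖ν‖ = 1) (hνX : ∀ j, inner ℝ (pderiv j X θ₀) ν = 0) :
    ∃ A : (Euc n × ℝ) ≃L[ℝ] Euc (n + 1),
      HasStrictFDerivAt (fun p : Euc n × ℝ => X p.1 + p.2 • ν)
        (A : (Euc n × ℝ) →L[ℝ] Euc (n + 1)) (θ₀, 0) ∧ ∀ p, inner ℝ ν (A p) = p.2 := by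
  set B : (Euc n × ℝ) →L[ℝ] Euc (n + 1) :=
    (fderiv ℝ X θ₀).coprod (ContinuousLinearMap.toSpanSingleton ℝ ν) with hB
  have hBp : ∀ p, B p = fderiv ℝ X θ₀ p.1 + p.2 • ν := fun p => by
    simp [hB]
  have hinner : ∀ p, inner ℝ ν (B p) = p.2 := by
    intro p
    rw [hBp, inner_add_right, inner_smul_right, real_inner_self_eq_norm_sq, hν,
      fderiv_apply_eq_sum, inner_sum]
    have h0 : ∀ j, inner ℝ ν (pderiv j X θ₀) = 0 := fun j => by rw [real_inner_comm, hνX]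
    simp [inner_smul_right, h0]
  have hinj : Function.Injective B := by
    rw [injective_iff_map_eq_zero]
    intro p hp
    have h2 : p.2 = 0 := by rw [← hinner p, hp, inner_zero_right]
    have h1 : fderiv ℝ X θ₀ p.1 = 0 := by
      have := hBp p
      rw [hp, h2, zero_smul, add_zero] at this
      exact this.symm
    exact Prod.ext (h.fderiv_injective hθ₀ h1) h2
  have hdim : Module.finrank ℝ (Euc n × ℝ) = Module.finrank ℝ (Euc (n + 1)) := by simp
  let A := (LinearMap.linearEquivOfInjective (B : (Euc n × ℝ) →ₗ[ℝ] Euc (n + 1)) hinj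
    hdim).toContinuousLinearEquiv
  have hA : ∀ p, A p = B p := fun p => rfl
  refine ⟨A, ?_, fun p => by rw [hA, hinner]⟩
  have hAB : (A : (Euc n × ℝ) →L[ℝ] Euc (n + 1)) = B := by ext1 <;> rfl
  rw [hAB]
  have hX := (h.contDiffAt hθ₀).hasStrictFDerivAt (by norm_num)
  have h1 : HasStrictFDerivAt (fun p : Euc n × ℝ => X p.1)
      ((fderiv ℝ X θ₀).comp (ContinuousLinearMap.fst ℝ (Euc n) ℝ)) (θ₀, 0) :=
    HasStrictFDerivAt.comp (θ₀, (0 : ℝ)) (f := Prod.fst) hX hasStrictFDerivAt_fst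
  have h2 : HasStrictFDerivAt (fun p : Euc n × ℝ => p.2 • ν)
      ((ContinuousLinearMap.snd ℝ (Euc n) ℝ).smulRight ν) (θ₀, 0) :=
    (hasStrictFDerivAt_snd (p := (θ₀, (0 : ℝ)))).smul_const ν
  refine (h1.add h2).congr_fderiv ?_
  ext1 <;> ext <;> simp [hB]

/-- Near `M` the hypersurface lies in the zero set of a function with differential `ν`. -/
lemma IsLocalParam.exists_defining_function (h : IsLocalParam Γ M Θ X) (hθ₀ : θ₀ ∈ Θ)
    (hX : X θ₀ = M) {ν : Euc (n + 1)} (hν : ‖ν‖ = 1)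
    (hνX : ∀ j, inner ℝ (pderiv j X θ₀) ν = 0) :
    ∃ φ : Euc (n + 1) → ℝ, HasFDerivAt φ (innerSL ℝ ν) M ∧ ∀ᶠ x in 𝓝 M, x ∈ Γ → φ x = 0 := by
  obtain ⟨A, hA, hAν⟩ := h.exists_normal_coordinates hθ₀ hν hνX
  have hM : X θ₀ + (0 : ℝ) • ν = M := by rw [zero_smul, add_zero, hX]
  have hinv := hA.to_localInverse.hasFDerivAt
  simp only [hM] at hinv
  -- The function is the normal coordinate `s`; `hAν` identifies its differential with the product
  -- by `ν`.
  refine ⟨fun x => (hA.localInverse _ _ _ x).2, ?_, ?_⟩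
  · refine (hasFDerivAt_snd.comp M hinv).congr_fderiv ?_
    ext1 v
    obtain ⟨p, rfl⟩ := A.surjective v
    simp [hAν]
  · have hleft := hA.eventually_left_inverse
    have hc : ContinuousAt (fun θ : Euc n => (θ, (0 : ℝ))) θ₀ := by fun_prop
    filter_upwards [h.eventually_exists hθ₀ hX (hc.eventually hleft)] with x hx hxΓ
    obtain ⟨θ, -, hθ, rfl⟩ := hx hxΓ
    have hθ' : hA.localInverse _ _ _ (X θ + (0 : ℝ) • ν) = (θ, (0 : ℝ)) := hθ
    rw [zero_smul, add_zero] at hθ'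
    rw [hθ']

/-- Orthogonality must hold in every parametrization. Curves of any other one stay in `Γ`, where the
defining function vanishes, so its differential kills their velocities. -/
lemma IsLocalParam.isUnitNormal (h : IsLocalParam Γ M Θ X) (hθ₀ : θ₀ ∈ Θ)
    (hX : X θ₀ = M) {ν : Euc (n + 1)} (hν : ‖ν‖ = 1)
    (hνX : ∀ j, inner ℝ (pderiv j X θ₀) ν = 0) : IsUnitNormal Γ M ν := by
  obtain ⟨φ, hφ, hφ0⟩ := h.exists_defining_function hθ₀ hX hν hνX
  refine ⟨hν, fun Θ' Y hY θ hθ hYθ j => ?_⟩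
  set c : ℝ → Euc n := fun t => θ + t • EuclideanSpace.single j (1 : ℝ) with hc
  have hc0 : c 0 = θ := by simp [hc]
  have hcd : HasDerivAt c (EuclideanSpace.single j (1 : ℝ)) 0 := by
    exact (((hasDerivAt_id (0 : ℝ)).smul_const (EuclideanSpace.single j (1 : ℝ))).const_add
      θ).congr_deriv (one_smul _ _)
  have hYd : HasFDerivAt Y (fderiv ℝ Y θ) (c 0) := by
    rw [hc0]
    exact ((hY.contDiffAt hθ).differentiableAt (by norm_num)).hasFDerivAt
  have hYc : HasDerivAt (Y ∘ c) (pderiv j Y θ) 0 := hYd.comp_hasDerivAt 0 hcd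
  have hYc0 : (Y ∘ c) 0 = M := by rw [Function.comp_apply, hc0, hYθ]
  have hd : HasDerivAt (φ ∘ Y ∘ c) (inner ℝ ν (pderiv j Y θ)) 0 :=
    HasFDerivAt.comp_hasDerivAt (l := φ) 0 (by rw [hYc0]; exact hφ) hYc
  have hev : φ ∘ Y ∘ c =ᶠ[𝓝 0] fun _ => 0 := by
    have h1 : ∀ᶠ t in 𝓝 (0 : ℝ), c t ∈ Θ' :=
      hcd.continuousAt.preimage_mem_nhds (by rw [hc0]; exact hY.isOpen.mem_nhds hθ)
    have h2 := hYc.continuousAt.tendsto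
    rw [hYc0] at h2
    filter_upwards [h1, h2.eventually hφ0] with t ht ht'
    exact ht' (hY.mem ht)
  rw [real_inner_comm]
  exact hd.unique ((hasDerivAt_const (0 : ℝ) (0 : ℝ)).congr_of_eventuallyEq hev)

/-- Normal coordinates cover a neighbourhood of `M`, and meet `Γ` only where `s = 0`. -/
lemma IsLocalParam.exists_tube (h : IsLocalParam Γ M Θ X) (hθ₀ : θ₀ ∈ Θ)
    (hX : X θ₀ = M) {ν : Euc (n + 1)} (hν : ‖ν‖ = 1)
    (hνX : ∀ j, inner ℝ (pderiv j X θ₀) ν = 0) {N : Set (Euc (n + 1))} (hN : N ∈ 𝓝 M) :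
    ∃ ρ : ℝ, 0 < ρ ∧ Metric.ball θ₀ ρ ⊆ Θ ∧
      (∀ θ ∈ Metric.ball θ₀ ρ, ∀ s : ℝ, |s| < ρ → X θ + s • ν ∈ Γ → s = 0) ∧
      (∀ θ ∈ Metric.ball θ₀ ρ, ∀ s : ℝ, |s| < ρ → X θ + s • ν ∈ N) ∧
      ∀ᶠ x in 𝓝 M, ∃ θ ∈ Metric.ball θ₀ ρ, ∃ s : ℝ, |s| < ρ ∧ X θ + s • ν = x := by
  obtain ⟨A, hA, -⟩ := h.exists_normal_coordinates hθ₀ hν hνX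
  set F : Euc n × ℝ → Euc (n + 1) := fun p => X p.1 + p.2 • ν with hF
  have hM : F (θ₀, 0) = M := by simp [hF, hX]
  set e := hA.toOpenPartialHomeomorph F
  have he : e.source ∈ 𝓝 (θ₀, (0 : ℝ)) :=
    e.open_source.mem_nhds hA.mem_toOpenPartialHomeomorph_source
  have hinj : InjOn F e.source := e.injOn
  have hc : ContinuousAt (fun θ : Euc n => (θ, (0 : ℝ))) θ₀ := by fun_prop
  have h1 := h.eventually_exists hθ₀ hX (hc.preimage_mem_nhds he)
  have hFc : Tendsto F (𝓝 (θ₀, 0)) (𝓝 M) := hM ▸ hA.continuousAt.tendsto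
  have h2 : ∀ᶠ p in 𝓝 (θ₀, (0 : ℝ)), p ∈ e.source ∧ p.1 ∈ Θ ∧ F p ∈ N ∧
      (F p ∈ Γ → ∃ θ ∈ Θ, θ ∈ (fun θ : Euc n => (θ, (0 : ℝ))) ⁻¹' e.source ∧ X θ = F p) :=
    Filter.Eventually.and he <| (continuousAt_fst.eventually (h.isOpen.mem_nhds hθ₀)).and <|
      (hFc.eventually hN).and (hFc.eventually h1)
  obtain ⟨ρ, hρ, hball⟩ := Metric.eventually_nhds_iff_ball.1 h2
  have hmem : ∀ θ ∈ Metric.ball θ₀ ρ, ∀ s : ℝ, |s| < ρ →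
      (θ, s) ∈ Metric.ball (θ₀, (0 : ℝ)) ρ := fun θ hθ s hs => by
    rw [← ball_prod_same]
    exact ⟨hθ, by simpa using hs⟩
  refine ⟨ρ, hρ, fun θ hθ => (hball _ (hmem θ hθ 0 (by simpa))).2.1, fun θ hθ s hs hΓ => ?_,
    fun θ hθ s hs => (hball _ (hmem θ hθ s hs)).2.2.1, ?_⟩
  · obtain ⟨hsrc, -, -, hex⟩ := hball _ (hmem θ hθ s hs)
    -- The same point also has the normal coordinates `(θ', 0)`, and these are unique in the source.
    obtain ⟨θ', -, hθ's, hθ'⟩ := hex hΓ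
    have : (θ', (0 : ℝ)) = (θ, s) := hinj hθ's hsrc (by simpa [hF] using hθ')
    exact (congrArg Prod.snd this).symm
  · have h3 : F '' Metric.ball (θ₀, (0 : ℝ)) ρ ∈ 𝓝 M := by
      rw [← hM, ← hA.map_nhds_eq_of_equiv]
      exact image_mem_map (Metric.ball_mem_nhds _ hρ)
    filter_upwards [h3]
    rintro x ⟨⟨θ, s⟩, hp, rfl⟩
    rw [← ball_prod_same] at hp
    exact ⟨θ, hp.1, s, by simpa using hp.2, rfl⟩

lemma subset_of_isPreconnected_of_disjoint_frontier {E : Type*} [TopologicalSpace E] {S D : Set E}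
    (hS : IsPreconnected S) (hSD : ∀ x ∈ S, x ∉ frontier D) (h : (S ∩ D).Nonempty) : S ⊆ D := by
  intro y hy
  by_contra hyD
  have hcover : S ⊆ interior D ∪ (closure D)ᶜ := by
    intro x hx
    by_cases hc : x ∈ closure D
    · exact Or.inl (by_contra fun hi => hSD x hx ⟨hc, hi⟩)
    · exact Or.inr hc
  obtain ⟨z, hzS, hzD⟩ := h
  obtain ⟨x, -, hx, hx'⟩ := hS _ _ isOpen_interior isClosed_closure.isOpen_compl hcover
    ⟨z, hzS, (hcover hzS).resolve_right fun h => h (subset_closure hzD)⟩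
    ⟨y, hy, (hcover hy).resolve_left fun h => hyD (interior_subset h)⟩
  exact hx' (subset_closure (interior_subset hx))

/-- One side of the tube is contained in `D` as soon as it meets `D`. -/
lemma tube_side_subset {D : Set (Euc (n + 1))} {ν : Euc (n + 1)} {ρ : ℝ}
    (hX : ContinuousOn X (Metric.ball θ₀ ρ))
    (hfr : ∀ θ ∈ Metric.ball θ₀ ρ, ∀ s : ℝ, |s| < ρ → X θ + s • ν ∈ frontier D → s = 0)
    (hex : ∃ θ ∈ Metric.ball θ₀ ρ, ∃ s : ℝ, 0 < s ∧ s < ρ ∧ X θ + s • ν ∈ D) :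
    ∀ θ ∈ Metric.ball θ₀ ρ, ∀ s : ℝ, 0 < s → s < ρ → X θ + s • ν ∈ D := by
  obtain ⟨θ', hθ', s', hs'0, hs', hmem⟩ := hex
  have hF : ContinuousOn (fun p : Euc n × ℝ => X p.1 + p.2 • ν) (Metric.ball θ₀ ρ ×ˢ Ioo 0 ρ) :=
    ContinuousOn.add (hX.comp continuousOn_fst fun p hp => hp.1)
      (continuousOn_snd.smul continuousOn_const)
  have hconn := ((convex_ball θ₀ ρ).prod (convex_Ioo 0 ρ)).isPreconnected.image _ hF
  have hsub := subset_of_isPreconnected_of_disjoint_frontier (D := D) hconn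
    (by
      rintro _ ⟨⟨θ, s⟩, ⟨hθ, hs⟩, rfl⟩ hx
      exact hs.1.ne' (hfr θ hθ s (by rw [abs_of_pos hs.1]; exact hs.2) hx))
    ⟨_, ⟨(θ', s'), ⟨hθ', hs'0, hs'⟩, rfl⟩, hmem⟩
  exact fun θ hθ s hs0 hs => hsub ⟨(θ, s), ⟨hθ, hs0, hs⟩, rfl⟩

/-- If an open set `D`, disjoint from the hypersurface `Γ`, accumulates at `M` and has no boundary
points off `Γ` near `M`, then some unit normal at the points of `Γ` near `M` looks into `D`. -/
lemma exists_unitNormal_into (hΓ : IsC2Hypersurface Γ) (hM : M ∈ Γ) {D : Set (Euc (n + 1))}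
    (hDΓ : Disjoint D Γ) (hMD : M ∈ closure D)
    (hfr : ∀ᶠ x in 𝓝 M, x ∈ frontier D → x ∈ Γ) :
    ∃ ν, IsUnitNormal Γ M ν ∧ ∃ ρ : ℝ, 0 < ρ ∧
      ∀ᶠ x in 𝓝 M, x ∈ Γ → ∀ s : ℝ, 0 < s → s < ρ → x + s • ν ∈ D := by
  obtain ⟨Θ, X, h⟩ := hΓ M hM
  obtain ⟨r, hr, himg⟩ := h.image_eq
  obtain ⟨θ₀, hθ₀, hX⟩ := himg.superset ⟨hM, Metric.mem_ball_self hr⟩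
  obtain ⟨ν, hν, hνX⟩ := exists_unit_orthogonal fun j => pderiv j X θ₀
  -- The tube is taken inside the neighbourhood given by `hfr`, so it meets the frontier of `D` only
  -- where `s = 0`.
  obtain ⟨ρ, hρ, hΘ, htube, hN, hcover⟩ := h.exists_tube hθ₀ hX hν hνX hfr
  have hXc : ContinuousOn X (Metric.ball θ₀ ρ) := h.contDiffOn.continuousOn.mono hΘ
  obtain ⟨x, ⟨θ, hθ, s, hs, rfl⟩, hxD⟩ :=
    ((mem_closure_iff_frequently.1 hMD).and_eventually hcover).exists.imp fun _ h => h.symm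
  have hs0 : s ≠ 0 := by
    rintro rfl
    rw [zero_smul, add_zero] at hxD
    exact hDΓ.notMem_of_mem_left hxD (h.mem (hΘ hθ))
  obtain ⟨ν', hν', hν'X, hside⟩ : ∃ ν' : Euc (n + 1), ‖ν'‖ = 1 ∧
      (∀ j, inner ℝ (pderiv j X θ₀) ν' = 0) ∧
      ∀ θ ∈ Metric.ball θ₀ ρ, ∀ s : ℝ, 0 < s → s < ρ → X θ + s • ν' ∈ D := by
    rcases hs0.lt_or_gt with hneg | hpos
    · refine ⟨-ν, by rwa [norm_neg], fun j => by rw [inner_neg_right, hνX, neg_zero],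
        tube_side_subset hXc (fun θ hθ s hs hx => ?_) ⟨θ, hθ, -s, by linarith, ?_, ?_⟩⟩
      · rw [smul_neg, ← neg_smul] at hx
        rw [← abs_neg] at hs
        exact neg_eq_zero.1 (htube θ hθ (-s) hs (hN θ hθ (-s) hs hx))
      · rwa [abs_of_neg hneg] at hs
      · rwa [smul_neg, neg_smul, neg_neg]
    · exact ⟨ν, hν, hνX, tube_side_subset hXc
        (fun θ hθ s hs hx => htube θ hθ s hs (hN θ hθ s hs hx))
        ⟨θ, hθ, s, hpos, (abs_of_pos hpos ▸ hs), hxD⟩⟩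
  refine ⟨ν', h.isUnitNormal hθ₀ hX hν' hν'X, ρ, hρ, ?_⟩
  filter_upwards [h.eventually_exists hθ₀ hX (Metric.ball_mem_nhds θ₀ hρ)] with x hx hxΓ s hs0 hs
  obtain ⟨θ, -, hθ, rfl⟩ := hx hxΓ
  exact hside θ hθ s hs0 hs

end HessianKernel

namespace HessianKernel

open Matrix Filter Topology Set

/-! ### The curvature matrix -/

section Curvature

variable {n : ℕ} {Γ : Set (Euc (n + 1))} {M : Euc (n + 1)} {Θ : Set (Euc n)}
  {X : Euc n → Euc (n + 1)} {θ : Euc n} {τ : Euc n → Matrix (Fin n) (Fin n) ℝ}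
  {ν : Euc (n + 1)}

lemma IsLocalParam.contDiffAt_fderiv (h : IsLocalParam Γ M Θ X) (hθ : θ ∈ Θ) :
    ContDiffAt ℝ 1 (fderiv ℝ X) θ :=
  (h.contDiffAt hθ).fderiv_right (by norm_num)

/-- The second fundamental form in the coordinates `θ`. -/
noncomputable def secondFundamentalForm (X : Euc n → Euc (n + 1)) (ν : Euc (n + 1)) (θ : Euc n) :
    Matrix (Fin n) (Fin n) ℝ :=
  Matrix.of fun l k => inner ℝ (pderiv k (pderiv l X) θ) ν

lemma IsLocalParam.pderiv_pderiv (h : IsLocalParam Γ M Θ X) (hθ : θ ∈ Θ) (k l : Fin n) :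
    pderiv k (pderiv l X) θ = fderiv ℝ (fderiv ℝ X) θ (EuclideanSpace.single k 1)
      (EuclideanSpace.single l 1) := by
  have hd := ((h.contDiffAt_fderiv hθ).differentiableAt (by norm_num)).hasFDerivAt.clm_apply
    (hasFDerivAt_const (EuclideanSpace.single l (1 : ℝ)) θ)
  change fderiv ℝ (fun x => fderiv ℝ X x (EuclideanSpace.single l 1)) θ _ = _
  rw [hd.fderiv]
  simp

lemma IsLocalParam.secondFundamentalForm_isSymm (h : IsLocalParam Γ M Θ X) (hθ : θ ∈ Θ) :
    (secondFundamentalForm X ν θ).IsSymm := by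
  ext k l
  simp only [secondFundamentalForm, transpose_apply, of_apply]
  rw [h.pderiv_pderiv hθ, h.pderiv_pderiv hθ,
    ((h.contDiffAt hθ).isSymmSndFDerivAt (by simp)).eq]

lemma IsLocalParam.dotProduct_secondFundamentalForm (h : IsLocalParam Γ M Θ X) (hθ : θ ∈ Θ)
    (v : Euc n) : v.ofLp ⬝ᵥ (secondFundamentalForm X ν θ *ᵥ v.ofLp) =
      inner ℝ (fderiv ℝ (fderiv ℝ X) θ v v) ν := by
  have hv : v = ∑ i, v i • EuclideanSpace.single i (1 : ℝ) := by
    ext j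
    simp [Finset.sum_apply, Pi.single_apply]
  have hexp : fderiv ℝ (fderiv ℝ X) θ v v =
      ∑ l, v l • ∑ k, v k • pderiv k (pderiv l X) θ := by
    have h1 : ∀ w, fderiv ℝ (fderiv ℝ X) θ w v =
        ∑ l, v l • fderiv ℝ (fderiv ℝ X) θ w (EuclideanSpace.single l 1) := by
      intro w
      conv_lhs => rw [hv]
      simp only [map_sum, map_smul]
    rw [h1]
    refine Finset.sum_congr rfl fun l _ => ?_
    congr 1
    rw [fderiv_apply_eq_sum, _root_.sum_apply]
    refine Finset.sum_congr rfl fun k _ => ?_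
    rw [h.pderiv_pderiv hθ]
    rfl
  rw [hexp, sum_inner]
  refine Finset.sum_congr rfl fun l _ => ?_
  rw [real_inner_smul_left, sum_inner, mulVec, dotProduct]
  congr 1
  refine Finset.sum_congr rfl fun k _ => ?_
  rw [real_inner_smul_left, mul_comm]
  rfl

/-- Differentiating `τ` yields only combinations of tangent vectors, which `ν` annihilates. -/
lemma IsLocalParam.curvatureMatrix_eq (h : IsLocalParam Γ M Θ X) (hτ : IsFrameField Θ X τ)
    (hθ : θ ∈ Θ) (hν : ∀ j, inner ℝ (pderiv j X θ) ν = 0) :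
    curvatureMatrix X τ ν θ = (τ θ)ᵀ * secondFundamentalForm X ν θ * τ θ := by
  have hτd : ∀ i j, DifferentiableAt ℝ (fun θ => τ θ i j) θ := fun i j =>
    ((hτ.1 i j).contDiffAt (h.isOpen.mem_nhds hθ)).differentiableAt (by norm_num)
  have hXd : ∀ l, DifferentiableAt ℝ (pderiv l X) θ := fun l =>
    differentiableAt_pderiv h.isOpen h.contDiffOn hθ l
  have hderiv : ∀ i k, inner ℝ (pderiv k (invDeriv τ i X) θ) ν =
      ∑ l, τ θ l i * secondFundamentalForm X ν θ l k := by
    intro i k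
    have hd := HasFDerivAt.fun_sum (u := Finset.univ) fun l (_ : l ∈ Finset.univ) =>
      (hτd l i).hasFDerivAt.smul (hXd l).hasFDerivAt
    have he : pderiv k (invDeriv τ i X) θ = _ :=
      congrArg (fun L : Euc n →L[ℝ] Euc (n + 1) => L (EuclideanSpace.single k 1)) hd.fderiv
    rw [he, _root_.sum_apply, sum_inner]
    refine Finset.sum_congr rfl fun l _ => ?_
    rw [_root_.add_apply, inner_add_left, _root_.smul_apply,
      ContinuousLinearMap.smulRight_apply, real_inner_smul_left, real_inner_smul_left, hν,
      mul_zero, add_zero]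
    rfl
  ext i j
  simp only [curvatureMatrix, of_apply]
  rw [invDeriv, sum_inner, Matrix.mul_apply]
  refine Finset.sum_congr rfl fun k _ => ?_
  rw [real_inner_smul_left, hderiv, Matrix.mul_apply, mul_comm]
  rfl

/-- The matrix `X_θ` of the tangent vectors. -/
noncomputable def jacobian (X : Euc n → Euc (n + 1)) (θ : Euc n) :
    Matrix (Fin (n + 1)) (Fin n) ℝ :=
  Matrix.of fun a k => pderiv k X θ a

lemma inner_eq_dotProduct {k : ℕ} (x y : Euc k) : inner ℝ x y = x.ofLp ⬝ᵥ y.ofLp := by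
  rw [EuclideanSpace.inner_eq_star_dotProduct, star_trivial, dotProduct_comm]

lemma metricTensor_eq (X : Euc n → Euc (n + 1)) (θ : Euc n) :
    metricTensor X θ = (jacobian X θ)ᵀ * jacobian X θ := by
  ext i j
  simp only [metricTensor, of_apply, inner_eq_dotProduct]
  rfl

lemma jacobian_mulVec (X : Euc n → Euc (n + 1)) (θ v : Euc n) :
    jacobian X θ *ᵥ v.ofLp = (fderiv ℝ X θ v).ofLp := by
  rw [fderiv_apply_eq_sum]
  ext a
  simp [jacobian, mulVec, dotProduct, mul_comm]

lemma IsFrameField.orthonormal (h : IsLocalParam Γ M Θ X) (hτ : IsFrameField Θ X τ)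
    (hθ : θ ∈ Θ) : (jacobian X θ * τ θ)ᵀ * (jacobian X θ * τ θ) = 1 := by
  have hdet : IsUnit (metricTensor X θ).det := (h.det_ne_zero θ hθ).isUnit
  have h1 : metricTensor X θ * τ θ * (τ θ)ᵀ = 1 := by
    rw [Matrix.mul_assoc, ← hτ.2 θ hθ, mul_nonsing_inv _ hdet]
  have h2 := mul_eq_one_comm.1 h1
  rwa [metricTensor_eq, ← Matrix.mul_assoc, ← Matrix.mul_assoc, ← transpose_mul,
    Matrix.mul_assoc] at h2

/-- The necessary conditions for a maximum at `M` of a function on `Γ` which is of class `C²` on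
one side of `Γ`. -/
lemma IsC2UpToBoundary.second_order_test_param {D : Set (Euc (n + 1))} {W : Euc (n + 1) → ℝ}
    {G : Euc (n + 1) → Fin (n + 1) → ℝ}
    {H : Euc (n + 1) → Matrix (Fin (n + 1)) (Fin (n + 1)) ℝ} (hD : IsOpen D)
    (hW : IsC2UpToBoundary D W G H) (h : IsLocalParam Γ M Θ X) (hθ : θ ∈ Θ) (hX : X θ = M)
    {ρ : ℝ} (hρ : 0 < ρ)
    (hin : ∀ᶠ x in 𝓝 M, x ∈ Γ → ∀ s : ℝ, 0 < s → s < ρ → x + s • ν ∈ D)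
    (hmax : ∀ᶠ x in 𝓝 M, x ∈ Γ → W x ≤ W M) (v : Euc n) :
    G M ⬝ᵥ (fderiv ℝ X θ v).ofLp = 0 ∧
      (fderiv ℝ X θ v).ofLp ⬝ᵥ (H M *ᵥ (fderiv ℝ X θ v).ofLp) +
        G M ⬝ᵥ (fderiv ℝ (fderiv ℝ X) θ v v).ofLp ≤ 0 := by
  set c : ℝ → Euc n := fun t => θ + t • v with hc
  have hc0 : c 0 = θ := by simp [hc]
  have hcd : ∀ t, HasDerivAt c v t := fun t =>
    (((hasDerivAt_id t).smul_const v).const_add θ).congr_deriv (one_smul _ _)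
  have hXc0 : X (c 0) = M := by rw [hc0, hX]
  have hXc : Tendsto (fun t => X (c t)) (𝓝 0) (𝓝 M) := by
    have h1 : ContinuousAt X (c 0) := by rw [hc0]; exact (h.contDiffAt hθ).continuousAt
    have h2 := (ContinuousAt.comp h1 (hcd 0).continuousAt).tendsto
    simp only [Function.comp_apply, hXc0] at h2
    exact h2
  have hev : ∀ᶠ t in 𝓝 (0 : ℝ), c t ∈ Θ ∧
      (X (c t) ∈ Γ → ∀ s : ℝ, 0 < s → s < ρ → X (c t) + s • ν ∈ D) ∧
      (X (c t) ∈ Γ → W (X (c t)) ≤ W M) :=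
    Filter.Eventually.and
      ((hcd 0).continuousAt.preimage_mem_nhds (by rw [hc0]; exact h.isOpen.mem_nhds hθ))
      ((hXc.eventually hin).and (hXc.eventually hmax))
  obtain ⟨ε, hε, hball⟩ := Metric.eventually_nhds_iff.1 hev
  have hball' : ∀ t : ℝ, |t| < min ε ρ → _ := fun t ht =>
    hball (y := t) (by simpa using ht.trans_le (min_le_left _ _))
  have key := hW.second_order_test hD (γ := fun t => X (c t)) (γ₁ := fun t => fderiv ℝ X (c t) v)
    (γ₂ := fun t => fderiv ℝ (fderiv ℝ X) (c t) v v) (ν := ν) (lt_min hε hρ)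
    (fun t ht => ((h.contDiffAt (hball' t ht).1).differentiableAt
      (by norm_num)).hasFDerivAt.comp_hasDerivAt t (hcd t))
    (fun t ht => by
      have h1 := ((h.contDiffAt_fderiv (hball' t ht).1).differentiableAt
        (by norm_num)).hasFDerivAt.comp_hasDerivAt t (hcd t)
      exact (h1.clm_apply (hasDerivAt_const t v)).congr_deriv (by simp))
    (by
      have h1 : ContinuousAt (fderiv ℝ (fderiv ℝ X)) (c 0) := by
        rw [hc0]
        exact ((h.contDiffAt_fderiv hθ).fderiv_right (m := 0) (by norm_num)).continuousAt
      have h2 := ContinuousAt.comp h1 (hcd 0).continuousAt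
      exact (h2.clm_apply continuousAt_const).clm_apply continuousAt_const)
    (fun t s ht hs0 hs => (hball' t ht).2.1 (h.mem (hball' t ht).1) s hs0
      (hs.trans_le (min_le_right _ _)))
    (fun t ht => by
      simp only [hXc0]
      exact (hball' t ht).2.2 (h.mem (hball' t ht).1))
  simpa only [hc0, hX] using key

/-- If `W` is `m`-admissible on the side of `Γ` to which `ν` points, has a maximum over `Γ` at `M`
and does not increase at `M` in the direction `ν`, then `Γ` is `(m - 1)`-convex at `M`. -/
lemma isPConvexAt_of_admissible {D : Set (Euc (n + 1))} {W : Euc (n + 1) → ℝ}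
    {G : Euc (n + 1) → Fin (n + 1) → ℝ}
    {H : Euc (n + 1) → Matrix (Fin (n + 1)) (Fin (n + 1)) ℝ} {m : ℕ} (hm : 1 ≤ m) (hD : IsOpen D)
    (hW : IsC2UpToBoundary D W G H) (hH : IsMPositive m (H M)) (hν : IsUnitNormal Γ M ν)
    {ρ : ℝ} (hρ : 0 < ρ)
    (hin : ∀ᶠ x in 𝓝 M, x ∈ Γ → ∀ s : ℝ, 0 < s → s < ρ → x + s • ν ∈ D)
    (hmax : ∀ᶠ x in 𝓝 M, x ∈ Γ → W x ≤ W M) (hG : G M ⬝ᵥ ν.ofLp ≤ 0) :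
    IsPConvexAt (m - 1) Γ ν M := by
  intro Θ X h τ hτ θ hθ hX
  have hνX := hν.2 Θ X h θ hθ hX
  have test := hW.second_order_test_param hD h hθ hX hρ hin hmax
  set J := jacobian X θ
  set E := J * τ θ
  set K := curvatureMatrix X τ ν θ
  have hK : K = (τ θ)ᵀ * secondFundamentalForm X ν θ * τ θ := h.curvatureMatrix_eq hτ hθ hνX
  have hKsymm : K.IsSymm := by
    rw [hK, IsSymm, transpose_mul, transpose_mul, transpose_transpose,
      (h.secondFundamentalForm_isSymm hθ).eq, Matrix.mul_assoc]
  have hE : Eᵀ * E = 1 := hτ.orthonormal h hθ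
  have hJν : Jᵀ *ᵥ ν.ofLp = 0 := by
    ext j
    have := hνX j
    rw [inner_eq_dotProduct] at this
    exact this
  have hEν : Eᵀ *ᵥ ν.ofLp = 0 := by
    rw [transpose_mul, ← mulVec_mulVec, hJν, mulVec_zero]
  have hνν : ν.ofLp ⬝ᵥ ν.ofLp = 1 := by
    rw [← inner_eq_dotProduct, real_inner_self_eq_norm_sq, hν.1, one_pow]
  have hEG : Eᵀ *ᵥ G M = 0 := by
    have hJG : Jᵀ *ᵥ G M = 0 := by
      ext j
      have := (test (EuclideanSpace.single j 1)).1
      rw [dotProduct_comm] at this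
      exact this
    rw [transpose_mul, ← mulVec_mulVec, hJG, mulVec_zero]
  -- Apply `E Eᵀ = 1 - ν νᵀ` to `G M`: the tangential part vanishes.
  have hGν : G M = (G M ⬝ᵥ ν.ofLp) • ν.ofLp := by
    have h1 := congrArg (· *ᵥ G M) (mul_transpose_eq_one_sub_of_orthonormal hE hνν hEν)
    simp only [← mulVec_mulVec, hEG, mulVec_zero, sub_mulVec, one_mulVec] at h1
    rw [sub_eq_zero.1 h1.symm, vecMulVec_mulVec, dotProduct_comm, op_smul_eq_smul, smul_dotProduct, hνν,
      smul_eq_mul, mul_one]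
  set κ := -(G M ⬝ᵥ ν.ofLp)
  have hquad : ∀ ξ, 0 ≤ ξ ⬝ᵥ ((κ • K - Eᵀ * H M * E) *ᵥ ξ) := by
    intro ξ
    -- The parameter direction whose tangent vector has coordinates `ξ` in the frame `E`.
    set v : Euc n := WithLp.toLp 2 (τ θ *ᵥ ξ)
    have hEξ : E *ᵥ ξ = (fderiv ℝ X θ v).ofLp := by
      rw [← jacobian_mulVec, ← mulVec_mulVec]
    have h1 : ξ ⬝ᵥ ((Eᵀ * H M * E) *ᵥ ξ) =
        (fderiv ℝ X θ v).ofLp ⬝ᵥ (H M *ᵥ (fderiv ℝ X θ v).ofLp) := by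
      rw [← hEξ, ← mulVec_mulVec, ← mulVec_mulVec, dotProduct_mulVec, vecMul_transpose]
    have h2 : ξ ⬝ᵥ (K *ᵥ ξ) = inner ℝ (fderiv ℝ (fderiv ℝ X) θ v v) ν := by
      rw [← h.dotProduct_secondFundamentalForm hθ, hK, ← mulVec_mulVec, ← mulVec_mulVec,
        dotProduct_mulVec, vecMul_transpose]
    have h3 : G M ⬝ᵥ (fderiv ℝ (fderiv ℝ X) θ v v).ofLp = -κ * (ξ ⬝ᵥ (K *ᵥ ξ)) := by
      rw [h2, inner_eq_dotProduct, hGν, smul_dotProduct, dotProduct_comm ν.ofLp, smul_eq_mul,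
        neg_neg]
    have h4 := (test v).2
    rw [h3, ← h1] at h4
    rw [sub_mulVec, dotProduct_sub, smul_mulVec, dotProduct_smul, smul_eq_mul]
    linarith
  have hcomp := hH.compress hm hE hνν hEν
  have hsymm : (κ • K - Eᵀ * H M * E).IsSymm := by
    exact IsSymm.sub (hKsymm.smul κ) hcomp.1
  have hpos := hcomp.add_posSemidef hsymm hquad
  rw [add_sub_cancel] at hpos
  refine ⟨hKsymm, fun p hp => ?_⟩
  have := hpos.2 p hp
  rw [pTrace_smul] at this
  -- `κ ^ p ≥ 0` and a positive product suffice, so `κ = 0` needs no separate treatment.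
  exact pos_of_mul_pos_right this (pow_nonneg (neg_nonneg.2 hG) p)

end Curvature

end HessianKernel

/-! ### Proof of the theorem -/

open Filter Topology in
theorem theorem6p7 (n m : ℕ) (hn : 1 ≤ n) (hm : 1 ≤ m) (hmn : m ≤ n + 1)
    (Ω : Set (HessianKernel.Euc (n + 1))) (hΩ_open : IsOpen Ω) (hΩ_conn : IsConnected Ω)
    (hΩ : HessianKernel.IsC2Hypersurface (frontier Ω))
    (M₀ : HessianKernel.Euc (n + 1)) (hM₀ : M₀ ∈ frontier Ω)
    (hW : ∃ W : HessianKernel.Euc (n + 1) → ℝ, HessianKernel.IsHessianKernel m Ω M₀ W) :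
    HessianKernel.BoundaryIsPConvexAt (m - 1) Ω M₀ := by
  obtain ⟨W, r, D, hr, hDom, ⟨G, H, hC2, hadm⟩, hWM, hWfr, hWΩ⟩ := hW
  have hD := hDom.isOpen
  have hDΩ : D ⊆ Ω := fun x hx => (hDom.subset hx).1
  have hDΓ : Disjoint D (frontier Ω) := by
    rw [hΩ_open.frontier_eq]
    exact Set.disjoint_left.2 fun x hx hx' => hx'.2 (hDΩ hx)
  have hsub : ∀ x ∈ frontier Ω ∩ Metric.ball M₀ r, x ∈ frontier D := fun x hx =>
    (hDom.frontier_eq.superset hx).1.1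
  have hMfr : M₀ ∈ frontier D := hsub M₀ ⟨hM₀, Metric.mem_ball_self hr⟩
  have hMD : M₀ ∈ closure D := frontier_subset_closure hMfr
  have hfr : ∀ᶠ x in 𝓝 M₀, x ∈ frontier D → x ∈ frontier Ω := by
    -- By continuity `W > -1` near `M₀`, which excludes frontier points of `D` inside `Ω`.
    have h1 : ∀ᶠ x in 𝓝[closure D] M₀, -1 < W x :=
      (hC2.continuousOn M₀ hMD).eventually (lt_mem_nhds (by rw [hWM]; norm_num))
    filter_upwards [eventually_nhdsWithin_iff.1 h1] with x hx hxD
    rw [hΩ_open.frontier_eq]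
    refine ⟨closure_mono hDΩ (frontier_subset_closure hxD), fun hxΩ => ?_⟩
    exact absurd (hx (frontier_subset_closure hxD)) (not_lt.2 (hWΩ x ⟨hxD, hxΩ⟩))
  obtain ⟨ν, hν, ρ, hρ, hin⟩ := HessianKernel.exists_unitNormal_into hΩ hM₀ hDΓ hMD hfr
  have hinM : ∀ s : ℝ, 0 < s → s < ρ → M₀ + s • ν ∈ D := hin.self_of_nhds hM₀
  have hWle := hC2.le_zero_of_frontier hD (Metric.isBounded_ball.subset fun x hx =>
      (hDom.subset hx).2)
    (fun x hx => by rw [← HessianKernel.pTrace_one]; exact (hadm x hx).2 1 hm) hWfr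
  have hmax : ∀ᶠ x in 𝓝 M₀, x ∈ frontier Ω → W x ≤ W M₀ := by
    filter_upwards [Metric.ball_mem_nhds M₀ hr] with x hx hxΓ
    rw [hWM]
    exact hWfr x (hsub x ⟨hxΓ, hx⟩)
  exact ⟨ν, ⟨hν, ρ, hρ, fun t h0 ht => hDΩ (hinM t h0 ht)⟩,
    HessianKernel.isPConvexAt_of_admissible hm hD hC2 (hadm M₀ hMD) hν hρ hin hmax
      (hC2.grad_dotProduct_nonpos hD (fun x hx => hWle x (subset_closure hx)) hMD hWM hρ hinM)⟩
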